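/- Let $n\ge 2$, and let $\mathfrak S_m$ be the symmetric group on $m$ letters, with $\mathfrak S_{n-1}\subset\mathfrak S_n$ the subgroup fixing the letter $n$. For $m\ge1$ put $$s_m=\sum_{i=1}^{m-1}\ \sum_{\substack{w\in\mathfrak S_m\\ w_1<\cdots<w_i,\ w_{i+1}<\cdots<w_m}}\mathrm{sgn}(w)\,w\ \in\ \mathbb Q\mathfrak S_m ,$$ and for $1\le j\le m$ let $$e_m^{(j)}=\prod_{1\le i\le m,\ i\ne j}\frac{s_m-(2^i-2)}{(2^j-2)-(2^i-2)}$$ be the $j$-th Eulerian idempotent, that is, the polynomial in $s_m$ projecting to its $(2^j-2)$-eigenspace. Let $E_m^{(j)}=e_m^{(j)}\,\mathbb Q\mathfrak S_m$ be the $j$-th Eulerian representation of $\mathfrak S_m$ (acting by right multiplication). With $c=(1,2,\ldots,n)$ and $\Lambda_n=\sum_{i=0}^{n-1}\mathrm{sgn}(c)^i c^i\in\mathbb Q\mathfrak S_n$, let $$F_n^{(j)}=\Lambda_n\,e_{n-1}^{(j)}\,\mathbb Q\mathfrak S_n\qquad(1\le j\le n-1)$$ be Whitehouse's lifts. Let $V^{(n-1,1)}$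 be the reflection representation of $\mathfrak S_n$ on the vectors of coordinate sum $0$ in $\mathbb Q^n$, and let $R(\mathfrak S_n)$ be the Grothendieck ring of finite-dimensional $\mathbb Q\mathfrak S_n$-modules, with sum $\oplus$ and product $\otimes$; a representation is also written for its class in $R(\mathfrak S_n)$. For every family $F^{(1)},\ldots,F^{(n-1)}$ of elements of $R(\mathfrak S_n)$ the following are equivalent: 1. (Whitehouse's virtual description) for $1\le j\le n-1$, $$F^{(j)}=\sum_{i=1}^{j}\left(E_{n-1}^{(i)}\uparrow_{\mathfrak S_{n-1}}^{\mathfrak S_n}-E_n^{(i)}\right);$$ 2. (graded relation) in $R(\mathfrak S_n)[[t]]$, $$\sum_{j=1}^{n}E_n^{(j)}\,t^{n-j}=\left(1+t\,V^{(n-1,1)}\right)\sum_{j=1}^{n-1}F^{(j)}\,t^{n-1-j};$$ 3. $F^{(j)}=F_n^{(j)}$ in $R(\mathfrak S_n)$ for $1\le j\le n-1$. In particular the classes of Whitehouse's lifts $F_n^{(j)}$ satisfy 1 and 2, and the coefficients of $t^{n-1}$ in 2 give the Getzler–Kapranov isomorphism of $\mathfrak S_n$-representations $$E_n^{(1)}\;\cong\;V^{(n-1,1)}\otimes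 F_n^{(1)} .$$ -/

import Mathlib

noncomputable section

namespace Whitehouse

open Equiv

/-! ### The representation ring -/

/-- The relations of the representation ring of `G` over `ℚ`: isomorphic representations have the
same class, direct sums go to sums, tensor products go to products, and the trivial
one-dimensional representation goes to `1`. -/
inductive RepRel (G : Type) [Group G] : MvPolynomial (FDRep ℚ G) ℤ → Prop
  | iso {V W : Type} [AddCommGroup V] [Module ℚ V] [Module.Finite ℚ V]
      [AddCommGroup W] [Module ℚ W] [Module.Finite ℚ W]
      (ρ : Representation ℚ G V) (σ : Representation ℚ G W) (h : Nonempty (ρ.Equiv σ)) :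
      RepRel G (MvPolynomial.X (FDRep.of ρ) - MvPolynomial.X (FDRep.of σ))
  | add {V W : Type} [AddCommGroup V] [Module ℚ V] [Module.Finite ℚ V]
      [AddCommGroup W] [Module ℚ W] [Module.Finite ℚ W]
      (ρ : Representation ℚ G V) (σ : Representation ℚ G W) :
      RepRel G (MvPolynomial.X (FDRep.of (ρ.prod σ)) -
        (MvPolynomial.X (FDRep.of ρ) + MvPolynomial.X (FDRep.of σ)))
  | mul {V W : Type} [AddCommGroup V] [Module ℚ V] [Module.Finite ℚ V]
      [AddCommGroup W] [Module ℚ W] [Module.Finite ℚ W]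
      (ρ : Representation ℚ G V) (σ : Representation ℚ G W) :
      RepRel G (MvPolynomial.X (FDRep.of (ρ.tprod σ)) -
        MvPolynomial.X (FDRep.of ρ) * MvPolynomial.X (FDRep.of σ))
  | one : RepRel G (MvPolynomial.X (FDRep.of (Representation.trivial ℚ G ℚ)) - 1)

/-- The Grothendieck ring `R(G)` of finite-dimensional representations of `G` over `ℚ`: the
commutative ring generated by the classes of representations, with `[A ⊕ B] = [A] + [B]`,
`[A ⊗ B] = [A] * [B]`, `[trivial] = 1`, and `[A] = [B]` when `A ≅ B`. -/
abbrev RepRing (G : Type) [Group G] : Type 1 :=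
  MvPolynomial (FDRep ℚ G) ℤ ⧸ Ideal.span {p | RepRel G p}

/-- The class in `R(G)` of a finite-dimensional representation. -/
def cls {G : Type} [Group G] {V : Type} [AddCommGroup V] [Module ℚ V] [Module.Finite ℚ V]
    (ρ : Representation ℚ G V) : RepRing G :=
  Ideal.Quotient.mk _ (MvPolynomial.X (FDRep.of ρ))

instance finiteMonoidAlgebra (G : Type) [Finite G] : Module.Finite ℚ (MonoidAlgebra ℚ G) :=
  Module.Finite.equiv (MonoidAlgebra.coeffLinearEquiv (S := ℚ) (R := ℚ) (M := G)).symm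

/-- Induction from a finite group preserves finite-dimensionality. -/
instance finiteInd {G H : Type} [Group G] [Group H] [Finite H] (φ : G →* H) {V : Type}
    [AddCommGroup V] [Module ℚ V] [Module.Finite ℚ V] (ρ : Representation ℚ G V) :
    Module.Finite ℚ (Representation.IndV φ ρ) := by
  have : Module.Finite ℚ (TensorProduct ℚ (MonoidAlgebra ℚ H) V) :=
    Module.Finite.tensorProduct ℚ (MonoidAlgebra ℚ H) V
  exact Module.Finite.quotient ℚ _

/-! ### Right ideals of the group algebra as representations -/

/-- The right regular representation of `G` on `ℚ[G]`; a right action is read as a left action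
through inverses, `g • x = x * g⁻¹`. -/
def rightRegular (G : Type) [Group G] : Representation ℚ G (MonoidAlgebra ℚ G) where
  toFun g := LinearMap.mulRight ℚ (MonoidAlgebra.single g⁻¹ (1 : ℚ))
  map_one' := by
    ext x
    simp [MonoidAlgebra.single_mul_single]
  map_mul' g h := by
    ext x
    simp [MonoidAlgebra.single_mul_single, mul_assoc]

/-- The right ideal `a ℚ[G]`, as a subrepresentation of the right regular representation. -/
def rightIdeal {G : Type} [Group G] (a : MonoidAlgebra ℚ G) :
    Subrepresentation (rightRegular G) where
  toSubmodule := LinearMap.range (LinearMap.mulLeft ℚ a)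
  apply_mem_toSubmodule := by
    rintro g _ ⟨x, rfl⟩
    exact ⟨x * MonoidAlgebra.single g⁻¹ 1, by simp [rightRegular, mul_assoc]⟩

/-! ### Eulerian idempotents and Eulerian representations -/

/-- `s_{i,n-i} = ∑ sgn(w) w`, over the permutations `w` with `w_1 < ⋯ < w_i` and
`w_{i+1} < ⋯ < w_n` (positions are counted from `0` in `Fin n`). -/
def shuffle (n i : ℕ) : MonoidAlgebra ℚ (Perm (Fin n)) :=
  ∑ w : Perm (Fin n) with
      ∀ a b : Fin n, a < b → ((b : ℕ) < i ∨ i ≤ (a : ℕ)) → w a < w b,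
    MonoidAlgebra.single w ((Perm.sign w : ℤ) : ℚ)

/-- `s_n = s_{1,n-1} + ⋯ + s_{n-1,1}`. -/
def totalShuffle (n : ℕ) : MonoidAlgebra ℚ (Perm (Fin n)) :=
  ∑ i ∈ Finset.Ico 1 n, shuffle n i

/-- The Eulerian idempotent `e_n^{(j)}`, `1 ≤ j ≤ n`: the polynomial in `s_n` projecting to its
eigenspace for the eigenvalue `2^j - 2`. The eigenvalues of `s_n` being `2^i - 2` for
`1 ≤ i ≤ n`, the polynomial is `∏_{i ≠ j} (x - (2^i - 2)) / ((2^j - 2) - (2^i - 2))`. -/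
def eulerianIdem (n j : ℕ) : MonoidAlgebra ℚ (Perm (Fin n)) :=
  Polynomial.aeval (totalShuffle n)
    (Lagrange.basis (Finset.Icc 1 n) (fun i : ℕ => (2 : ℚ) ^ i - 2) j)

/-- The Eulerian representation `E_n^{(j)} = e_n^{(j)} ℚ[S_n]`. -/
def E (n j : ℕ) : Representation ℚ (Perm (Fin n)) (rightIdeal (eulerianIdem n j)).toSubmodule :=
  (rightIdeal (eulerianIdem n j)).toRepresentation

/-! ### Whitehouse's lifts -/

/-- The inclusion `S_{n-1} → S_n` as the permutations fixing the last letter. -/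
def incl (n : ℕ) : Perm (Fin (n - 1)) →* Perm (Fin n) :=
  Perm.viaEmbeddingHom (Fin.castLEEmb (Nat.sub_le n 1))

/-- `Λ_n = ∑_{i < n} sgn(c)^i c^i` for the `n`-cycle `c = (1, 2, …, n)`. -/
def cyc (n : ℕ) : MonoidAlgebra ℚ (Perm (Fin n)) :=
  ∑ i ∈ Finset.range n,
    MonoidAlgebra.single (finRotate n ^ i) (((Perm.sign (finRotate n) : ℤ) : ℚ) ^ i)

/-- The generator `Λ_n e_{n-1}^{(j)}` of Whitehouse's right ideal. -/
def liftElt (n j : ℕ) : MonoidAlgebra ℚ (Perm (Fin n)) :=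
  cyc n * MonoidAlgebra.mapDomain (incl n) (eulerianIdem (n - 1) j)

/-- Whitehouse's lift `F_n^{(j)} = Λ_n e_{n-1}^{(j)} ℚ[S_n]`. -/
def F (n j : ℕ) : Representation ℚ (Perm (Fin n)) (rightIdeal (liftElt n j)).toSubmodule :=
  (rightIdeal (liftElt n j)).toRepresentation

/-- The representation of `S_n` induced from the Eulerian representation `E_{n-1}^{(j)}`
of `S_{n-1}`. -/
def indE (n j : ℕ) :
    Representation ℚ (Perm (Fin n)) (Representation.IndV (incl n) (E (n - 1) j)) :=
  Representation.ind (incl n) (E (n - 1) j)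

/-! ### The reflection representation -/

/-- The permutation representation of `S_n` on `ℚ^n`. -/
def permRep (n : ℕ) : Representation ℚ (Perm (Fin n)) (Fin n → ℚ) where
  toFun w := LinearMap.funLeft ℚ ℚ (w⁻¹ : Perm (Fin n))
  map_one' := rfl
  map_mul' _ _ := by
    ext
    simp [LinearMap.funLeft]

/-- The vectors of coordinate sum `0` in `ℚ^n`, as a subrepresentation. -/
def reflectionSub (n : ℕ) : Subrepresentation (permRep n) where
  toSubmodule :=
    { carrier := {v | ∑ i, v i = 0}
      add_mem' := fun {v w} hv hw => by
        simp only [Set.mem_ofPred_eq] at hv hw ⊢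
        simp [Finset.sum_add_distrib, hv, hw]
      zero_mem' := by simp
      smul_mem' := fun c v hv => by
        simp only [Set.mem_ofPred_eq] at hv ⊢
        simp [← Finset.mul_sum, hv] }
  apply_mem_toSubmodule := fun w v hv => by
    change ∑ i, v (w⁻¹ i) = 0
    rw [Equiv.sum_comp (w⁻¹) v]
    exact hv

/-- The irreducible reflection representation `V^{(n-1,1)}` of `S_n`, for `n ≥ 2`. -/
def reflection (n : ℕ) : Representation ℚ (Perm (Fin n)) (reflectionSub n).toSubmodule :=
  (reflectionSub n).toRepresentation

end Whitehouse

end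

/-! Write n = m + 1. Characters determine classes, so everything reduces to two character identities
for the lifts; both come from computations in the group algebra. Up to the twist w ↦ sgn(w) w, the
element s_n + 2 is the sum S_2 of the sorting permutations of all binary words. For k letters, S_k
S_l = S_{kl} (`sortSum_fin_mul`) and S_k is a polynomial in k, whose coefficients are therefore
eigenvectors of S_2 with eigenvalues 2^j. Since S_1 = 1 is their sum, s_n is diagonalizable with
eigenvalues among the 2^j - 2. Splitting binary words by their first or last letter gives, with D =
1 - sgn(c) c⁻¹, the relations D s_n = s_m D and Λ(2 s_m + 2) = s_n Λ. On idempotents they become D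
e_n^{(j)} = e_m^{(j)} D and Λ e_m^{(j)} = e_n^{(j+1)} Λ. If a² = r a, the character of a ℚ[G] at g
is r⁻¹ times the sum of the coefficients of a over the conjugates of g, and this sum is a trace. As
n - Λ is a multiple of D, the relations yield F^{(j)} + Ind E_m^{(j+1)} = F^{(j+1)} + E_n^{(j+1)}
(`character_F_add_indE`). Moreover Λ e_m^{(j)} is invariant under conjugation by c and agrees with
e_m^{(j)} on the permutations fixing n, so fix(g) χ_F(g) = χ_{Ind E}(g) (`card_mul_character_F`).
The first identity telescopes to description 1. As V^{(n-1,1)} has character fix - 1, the two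
together give E_n^{(j+1)} = F^{(j)} + V ⊗ F^{(j+1)}, which is relation 2; it determines the family
because 1 + tV is a unit. -/

noncomputable section

namespace Whitehouse

open Equiv

/-! ### Representations with equal characters are isomorphic -/

section Characters

universe u

variable {k G : Type*} [Field k] [Group G]

/-- Complementary subrepresentations are complementary subspaces. -/
theorem isCompl_toSubmodule {V : Type*} [AddCommGroup V] [Module k V] {ρ : Representation k G V}
    {P Q : Subrepresentation ρ} (h : IsCompl P Q) : IsCompl P.toSubmodule Q.toSubmodule :=
  ⟨disjoint_iff.2 (congrArg Subrepresentation.toSubmodule (disjoint_iff.1 h.1)),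
    codisjoint_iff.2 (congrArg Subrepresentation.toSubmodule (codisjoint_iff.1 h.2))⟩

/-- A representation is the direct sum of two complementary subrepresentations. -/
def prodEquivOfIsCompl {V : Type*} [AddCommGroup V] [Module k V] {ρ : Representation k G V}
    {P Q : Subrepresentation ρ} (h : IsCompl P Q) :
    (P.toRepresentation.prod Q.toRepresentation).Equiv ρ :=
  .mk (Submodule.prodEquivOfIsCompl _ _ (isCompl_toSubmodule h)) fun g => by
    refine LinearMap.ext fun x => ?_
    simp [Subrepresentation.toRepresentation]

/-- Isomorphic summands have isomorphic direct sums. -/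
def prodCongr {V₁ V₂ W₁ W₂ : Type*} [AddCommGroup V₁] [Module k V₁] [AddCommGroup V₂] [Module k V₂]
    [AddCommGroup W₁] [Module k W₁] [AddCommGroup W₂] [Module k W₂]
    {ρ₁ : Representation k G V₁} {ρ₂ : Representation k G V₂}
    {σ₁ : Representation k G W₁} {σ₂ : Representation k G W₂}
    (e₁ : ρ₁.Equiv σ₁) (e₂ : ρ₂.Equiv σ₂) : (ρ₁.prod ρ₂).Equiv (σ₁.prod σ₂) :=
  .mk (e₁.toLinearEquiv.prodCongr e₂.toLinearEquiv) fun g => by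
    refine LinearMap.ext fun x => Prod.ext ?_ ?_
    · exact e₁.toIntertwiningMap.isIntertwining _ _ g x.1
    · exact e₂.toIntertwiningMap.isIntertwining _ _ g x.2

theorem character_prod {V W : Type*} [AddCommGroup V] [Module k V] [FiniteDimensional k V]
    [AddCommGroup W] [Module k W] [FiniteDimensional k W]
    (ρ : Representation k G V) (σ : Representation k G W) (g : G) :
    (ρ.prod σ).character g = ρ.character g + σ.character g :=
  LinearMap.trace_prodMap' _ _

/-- An intertwining map restricts to an isomorphism from a complement of its kernel to its
range. -/
def equivRangeOfIsCompl {V W : Type*} [AddCommGroup V] [Module k V]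
    [AddCommGroup W] [Module k W] {ρ : Representation k G V} {σ : Representation k G W}
    (f : ρ.IntertwiningMap σ) {Q : Subrepresentation ρ} (h : IsCompl f.ker Q) :
    Q.toRepresentation.Equiv f.range.toRepresentation :=
  .mk (LinearEquiv.ofBijective
    ((f.toLinearMap.comp Q.toSubmodule.subtype).codRestrict (LinearMap.range f.toLinearMap)
      fun x => ⟨x, rfl⟩) (by
    have hc := isCompl_toSubmodule h
    constructor
    · refine (injective_iff_map_eq_zero _).2 fun x hx => ?_
      exact Subtype.ext (Submodule.disjoint_def.1 hc.1 x (congrArg Subtype.val hx) x.2)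
    · rintro ⟨_, v, rfl⟩
      obtain ⟨a, ha, b, hb, rfl⟩ : ∃ a ∈ f.ker.toSubmodule, ∃ b ∈ Q.toSubmodule, a + b = v :=
        Submodule.mem_sup.1 (hc.sup_eq_top ▸ Submodule.mem_top)
      have ha' : f.toLinearMap a = 0 := ha
      refine ⟨⟨b, hb⟩, Subtype.ext ?_⟩
      change f.toLinearMap b = f.toLinearMap (a + b)
      rw [map_add, ha', zero_add])) fun g => by
    refine LinearMap.ext fun x => Subtype.ext ?_
    exact f.isIntertwining _ _ g x

/-- Induction on dimension, with no splitting field needed: dim Hom(ρ, σ) is computed from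
characters, so it equals dim End ρ, which is positive when ρ ≠ 0. A nonzero map identifies a
complement of its kernel with its range; the kernel and a complement of the range then have equal
characters and smaller dimension. -/
theorem nonempty_equiv_of_character_eq [CharZero k] [Finite G] {V W : Type u}
    [AddCommGroup V] [Module k V] [FiniteDimensional k V]
    [AddCommGroup W] [Module k W] [FiniteDimensional k W]
    (ρ : Representation k G V) (σ : Representation k G W) (h : ∀ g, ρ.character g = σ.character g) :
    Nonempty (ρ.Equiv σ) := by
  induction hm : Module.finrank k V using Nat.strong_induction_on generalizing V W with
  | _ m ih =>
  have := Fintype.ofFinite G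
  have hG : (Nat.card G : k) ≠ 0 := Nat.cast_ne_zero.2 Nat.card_pos.ne'
  have : NeZero (Nat.card G : k) := ⟨hG⟩
  have : Invertible (Nat.card G : k) := invertibleOfNonzero hG
  have hdim : Module.finrank k V = Module.finrank k W := by
    have := h 1
    rw [Representation.char_one, Representation.char_one] at this
    exact_mod_cast this
  by_cases hV : Module.finrank k V = 0
  · have := Module.finrank_zero_iff.1 hV
    have := Module.finrank_zero_iff.1 (hdim ▸ hV)
    exact ⟨.mk (LinearEquiv.ofFinrankEq V W hdim) fun g =>
      LinearMap.ext fun x => Subsingleton.elim _ _⟩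
  obtain ⟨f, hf⟩ : ∃ f : ρ.IntertwiningMap σ, f ≠ 0 := by
    by_contra! hno
    have h1 := Representation.card_inv_mul_sum_char_mul_char_eq_finrank ρ ρ
    have h2 := Representation.card_inv_mul_sum_char_mul_char_eq_finrank ρ σ
    simp only [← h] at h2
    rw [h1, Nat.cast_inj] at h2
    have : Subsingleton (ρ.IntertwiningMap σ) := ⟨fun a b => (hno a).trans (hno b).symm⟩
    rw [Module.finrank_zero_of_subsingleton (M := ρ.IntertwiningMap σ),
      Module.finrank_zero_iff] at h2
    have h0 := Subsingleton.elim (Representation.IntertwiningMap.id ρ) 0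
    refine hV (Module.finrank_zero_iff.2 ⟨fun a b => ?_⟩)
    have h3 : ∀ v : V, v = 0 := fun v => congrArg (fun φ : ρ.IntertwiningMap ρ => φ v) h0
    rw [h3 a, h3 b]
  obtain ⟨Q, hQ⟩ := exists_isCompl f.ker
  obtain ⟨C, hC⟩ := exists_isCompl f.range
  have hlt : Module.finrank k f.ker.toSubmodule < m := by
    rw [← hm]
    refine Submodule.finrank_lt fun htop => hf ?_
    ext x
    exact (htop ▸ Submodule.mem_top : x ∈ f.ker.toSubmodule)
  have e₁ := equivRangeOfIsCompl f hQ
  have e₂ := prodEquivOfIsCompl hQ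
  have e₃ := prodEquivOfIsCompl hC
  obtain ⟨e₄⟩ := ih _ hlt f.ker.toRepresentation C.toRepresentation (fun g => by
    have h2 := congrFun (Representation.char_iso e₂) g
    have h3 := congrFun (Representation.char_iso e₃) g
    have h1 := congrFun (Representation.char_iso e₁) g
    rw [character_prod] at h2 h3
    rw [h, ← h3, h1, add_comm] at h2
    exact add_left_cancel h2) rfl
  have e₅ : (C.toRepresentation.prod f.range.toRepresentation).Equiv
      (f.range.toRepresentation.prod C.toRepresentation) :=
    .mk (LinearEquiv.prodComm k _ _) fun g => LinearMap.ext fun x => rfl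
  exact ⟨e₂.symm.trans ((prodCongr e₄ e₁).trans (e₅.trans e₃))⟩

end Characters

/-! ### Classes in the representation ring -/

section Classes

variable {G : Type} [Group G] {V W : Type} [AddCommGroup V] [Module ℚ V] [Module.Finite ℚ V]
  [AddCommGroup W] [Module ℚ W] [Module.Finite ℚ W]

theorem cls_eq_of_equiv (ρ : Representation ℚ G V) (σ : Representation ℚ G W)
    (e : Nonempty (ρ.Equiv σ)) : cls ρ = cls σ :=
  Ideal.Quotient.eq.2 (Ideal.subset_span (.iso ρ σ e))

theorem cls_eq_of_character_eq [Finite G] (ρ : Representation ℚ G V) (σ : Representation ℚ G W)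
    (h : ∀ g, ρ.character g = σ.character g) : cls ρ = cls σ :=
  cls_eq_of_equiv ρ σ (nonempty_equiv_of_character_eq ρ σ h)

theorem cls_prod (ρ : Representation ℚ G V) (σ : Representation ℚ G W) :
    cls (ρ.prod σ) = cls ρ + cls σ := by
  rw [cls, cls, cls, ← map_add]
  exact Ideal.Quotient.eq.2 (Ideal.subset_span (.add ρ σ))

theorem cls_tprod (ρ : Representation ℚ G V) (σ : Representation ℚ G W) :
    cls (ρ.tprod σ) = cls ρ * cls σ := by
  rw [cls, cls, cls, ← map_mul]
  exact Ideal.Quotient.eq.2 (Ideal.subset_span (.mul ρ σ))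

/-- Both ρ ⊕ ρ and ρ have character zero, so [ρ] + [ρ] = [ρ]. -/
theorem cls_eq_zero_of_character_eq_zero [Finite G] (ρ : Representation ℚ G V)
    (h : ∀ g, ρ.character g = 0) : cls ρ = 0 := by
  have h1 := cls_eq_of_character_eq (ρ.prod ρ) ρ fun g => by rw [character_prod, h, add_zero]
  rwa [cls_prod, add_eq_left] at h1

variable {U X : Type} [AddCommGroup U] [Module ℚ U] [Module.Finite ℚ U]
  [AddCommGroup X] [Module ℚ X] [Module.Finite ℚ X]

theorem nonempty_equiv_tprod_of_character_eq [Finite G] (ρ : Representation ℚ G V)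
    (σ : Representation ℚ G W) (τ : Representation ℚ G U)
    (h : ∀ g, ρ.character g = σ.character g * τ.character g) :
    Nonempty (ρ.Equiv (σ.tprod τ)) :=
  nonempty_equiv_of_character_eq ρ (W := TensorProduct ℚ W U) (σ.tprod τ) fun g => by
    rw [h, Representation.char_tensor, Pi.mul_apply]

theorem cls_eq_add_mul_of_character_eq [Finite G] (ρ : Representation ℚ G V)
    (α : Representation ℚ G X) (σ : Representation ℚ G W) (τ : Representation ℚ G U)
    (h : ∀ g, ρ.character g = α.character g + σ.character g * τ.character g) :
    cls ρ = cls α + cls σ * cls τ := by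
  rw [← cls_tprod, ← cls_prod]
  refine cls_eq_of_character_eq (W := X × TensorProduct ℚ W U) _ _ fun g => ?_
  rw [h, character_prod, Representation.char_tensor, Pi.mul_apply]

end Classes

/-! ### Characters of right ideals -/

section RightIdeal

variable {G : Type} [Group G] [Fintype G]

/-- The sum `∑ h, a (h g h⁻¹)` of the coefficients of `a ∈ ℚ[G]` over the conjugates of `g`. -/
def conjSum (g : G) : MonoidAlgebra ℚ G →ₗ[ℚ] ℚ where
  toFun a := ∑ h : G, a.coeff (h * g * h⁻¹)
  map_add' a b := by simp [Finset.sum_add_distrib]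
  map_smul' r a := by simp [Finset.mul_sum]

theorem conjSum_apply (g : G) (a : MonoidAlgebra ℚ G) :
    conjSum g a = ∑ h : G, a.coeff (h * g * h⁻¹) := rfl

/-- For group elements, uv and vu are conjugate by u, so the substitution h ↦ u⁻¹h exchanges the two
sums. -/
theorem conjSum_mul_comm (g : G) (a b : MonoidAlgebra ℚ G) :
    conjSum g (a * b) = conjSum g (b * a) := by
  classical
  induction a using MonoidAlgebra.induction_linear with
  | zero => simp
  | add x y hx hy => rw [add_mul, mul_add, map_add, map_add, hx, hy]
  | single u r =>
  induction b using MonoidAlgebra.induction_linear with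
  | zero => simp
  | add x y hx hy => rw [add_mul, mul_add, map_add, map_add, hx, hy]
  | single v s =>
  rw [conjSum_apply, conjSum_apply]
  refine Fintype.sum_equiv (Equiv.mulLeft u⁻¹) _ _ fun h => ?_
  simp only [MonoidAlgebra.single_mul_single, MonoidAlgebra.coeff_single, Finsupp.single_apply,
    mul_comm r s, Equiv.coe_mulLeft]
  congr 1
  rw [eq_iff_iff]
  constructor <;> intro H
  · rw [show u⁻¹ * h * g * (u⁻¹ * h)⁻¹ = u⁻¹ * (h * g * h⁻¹) * u by group, ← H]; group
  · rw [show h * g * h⁻¹ = u * (u⁻¹ * h * g * (u⁻¹ * h)⁻¹) * u⁻¹ by group, ← H]; group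

/-- In the basis of group elements, the diagonal entry of x ↦ a x g⁻¹ at h is the coefficient of a
at h g h⁻¹. -/
theorem trace_mulLeft_mulRight (g : G) (a : MonoidAlgebra ℚ G) :
    LinearMap.trace ℚ _ (LinearMap.mulLeft ℚ a ∘ₗ rightRegular G g) = conjSum g a := by
  classical
  rw [LinearMap.trace_eq_matrix_trace ℚ (Module.Basis.ofRepr (MonoidAlgebra.coeffLinearEquiv ℚ)),
    Matrix.trace, conjSum_apply]
  refine Finset.sum_congr rfl fun h _ => ?_
  simp [LinearMap.toMatrix_apply, rightRegular, MonoidAlgebra.single_mul_single,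
    MonoidAlgebra.coeff_mul_single_apply, mul_assoc]

/-- The character of a right ideal generated by a multiple of an idempotent. -/
theorem character_rightIdeal {r : ℚ} {a : MonoidAlgebra ℚ G} (h : a * a = r • a) (g : G) :
    r * (rightIdeal a).toRepresentation.character g = conjSum g a := by
  -- The map x ↦ a x g⁻¹ has image in a ℚ[G], so its trace can be taken there, where left
  -- multiplication by a is the scalar r.
  rw [← trace_mulLeft_mulRight, ← LinearMap.trace_restrict_eq_of_forall_mem
    (rightIdeal a).toSubmodule (LinearMap.mulLeft ℚ a ∘ₗ rightRegular G g) (fun x => ⟨_, rfl⟩),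
    Representation.character, ← smul_eq_mul, ← map_smul]
  congr 1
  refine LinearMap.ext fun x => Subtype.ext ?_
  obtain ⟨_, x, rfl⟩ := x
  simp [Subrepresentation.toRepresentation, rightRegular, ← mul_assoc, h]

end RightIdeal

/-! ### Induction of right ideals -/

section Induction

variable {H G : Type} [Group H] [Group G] (φ : H →* G)

/-- The map of group algebras induced by a homomorphism of groups. -/
abbrev algMap : MonoidAlgebra ℚ H →ₐ[ℚ] MonoidAlgebra ℚ G := MonoidAlgebra.mapDomainAlgHom ℚ ℚ φ

/-- The element `a z` of the right ideal `a ℚ[H]`. -/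
def rightIdealMk (a z : MonoidAlgebra ℚ H) : (rightIdeal a).toSubmodule := ⟨a * z, z, rfl⟩

/-- Passing to coinvariants allows z to move across the tensor sign; hence classes y ⊗ a generate
the induced representation. -/
theorem indV_mk_rightIdealMk (a z : MonoidAlgebra ℚ H) (g : G) :
    Representation.Coinvariants.mk
      (Representation.tprod ((Representation.leftRegular ℚ G).comp φ)
        (rightIdeal a).toRepresentation)
      ((algMap φ z * .single g 1) ⊗ₜ rightIdealMk a 1) =
    Representation.IndV.mk φ (rightIdeal a).toRepresentation g (rightIdealMk a z) := by
  induction z using MonoidAlgebra.induction_linear with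
  | zero =>
    have : rightIdealMk a 0 = 0 := Subtype.ext (mul_zero a)
    rw [this, map_zero, map_zero, zero_mul, TensorProduct.zero_tmul, map_zero]
  | add y z hy hz =>
    have : rightIdealMk a (y + z) = rightIdealMk a y + rightIdealMk a z :=
      Subtype.ext (mul_add a y z)
    rw [this, map_add, map_add, add_mul, TensorProduct.add_tmul, map_add, hy, hz]
  | single h r =>
    have h1 := Representation.Coinvariants.mk_self_apply
      (Representation.tprod ((Representation.leftRegular ℚ G).comp φ)
        (rightIdeal a).toRepresentation) h
      (MonoidAlgebra.single g 1 ⊗ₜ rightIdealMk a (.single h r))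
    have h2 : (rightIdeal a).toRepresentation h (rightIdealMk a (.single h r)) =
        r • rightIdealMk a 1 := by
      refine Subtype.ext ?_
      change a * .single h r * .single h⁻¹ 1 = r • (a * 1)
      rw [mul_assoc, MonoidAlgebra.single_mul_single, mul_inv_cancel, MonoidAlgebra.one_def,
        ← mul_smul_comm, MonoidAlgebra.smul_single, smul_eq_mul]
    refine Eq.trans ?_ h1
    rw [Representation.tprod_apply, TensorProduct.map_tmul, h2, ← TensorProduct.smul_tmul]
    congr 2
    simp [MonoidAlgebra.single_mul_single]

/-- The representation induced from the right ideal of an idempotent is the right ideal of the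
same idempotent in the bigger group algebra. -/
theorem nonempty_ind_equiv {e : MonoidAlgebra ℚ H} (he : e * e = e) :
    Nonempty ((Representation.ind φ (rightIdeal e).toRepresentation).Equiv
      (rightIdeal (algMap φ e)).toRepresentation) := by
  let ρ := (rightIdeal e).toRepresentation
  have hmem : ∀ x : (rightIdeal e).toSubmodule, e * x.1 = x.1 := by
    rintro ⟨_, x, rfl⟩
    simp [← mul_assoc, he]
  -- The map y ⊗ x ↦ φ(x) y descends to coinvariants because h acts by φ(h) on the left of y and by
  -- h⁻¹ on the right of x.
  let F₀ : TensorProduct ℚ (MonoidAlgebra ℚ G) (rightIdeal e).toSubmodule →ₗ[ℚ]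
      MonoidAlgebra ℚ G :=
    TensorProduct.lift ((LinearMap.mul ℚ (MonoidAlgebra ℚ G)).flip.compl₂
      ((algMap φ).toLinearMap ∘ₗ (rightIdeal e).toSubmodule.subtype))
  have hF₀ : ∀ y x, F₀ (y ⊗ₜ x) = algMap φ x.1 * y := fun y x => rfl
  let F₁ : Representation.IndV φ ρ →ₗ[ℚ] MonoidAlgebra ℚ G :=
    Representation.Coinvariants.lift _ F₀ fun h => by
      refine TensorProduct.ext' fun y x => ?_
      induction y using MonoidAlgebra.induction_linear with
      | zero => simp
      | add y z hy hz => rw [TensorProduct.add_tmul, map_add, map_add, hy, hz]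
      | single g r =>
        change algMap φ (x.1 * .single h⁻¹ 1) * _ = algMap φ x.1 * .single g r
        rw [map_mul, mul_assoc]
        simp [MonoidAlgebra.single_mul_single]
  have hF₁ : ∀ g x, F₁ (Representation.IndV.mk φ ρ g x) = algMap φ x.1 * .single g 1 :=
    fun g x => rfl
  let G₁ : MonoidAlgebra ℚ G →ₗ[ℚ] Representation.IndV φ ρ :=
    Representation.Coinvariants.mk _ ∘ₗ (TensorProduct.mk ℚ _ _).flip (rightIdealMk e 1)
  have hFG : ∀ y, F₁ (G₁ y) = algMap φ e * y := fun y =>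
    congrArg (fun z => algMap φ z * y) (mul_one e)
  have hrange : ∀ x, F₁ x ∈ (rightIdeal (algMap φ e)).toSubmodule := by
    intro x
    induction x using Representation.Coinvariants.induction_on with | _ x
    change F₀ x ∈ _
    induction x using TensorProduct.induction_on with
    | zero => rw [map_zero]; exact Submodule.zero_mem _
    | add x y hx hy => rw [map_add]; exact Submodule.add_mem _ hx hy
    | tmul y x =>
      refine ⟨algMap φ x.1 * y, ?_⟩
      rw [hF₀, LinearMap.mulLeft_apply, ← mul_assoc, ← map_mul, hmem]
  refine ⟨.mk (LinearEquiv.ofLinearMap (F₁.codRestrict _ hrange)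
    (G₁ ∘ₗ (rightIdeal (algMap φ e)).toSubmodule.subtype) ?_ ?_) ?_⟩
  · refine LinearMap.ext fun y => Subtype.ext ?_
    obtain ⟨_, y, rfl⟩ := y
    change F₁ (G₁ (algMap φ e * y)) = algMap φ e * y
    rw [hFG, ← mul_assoc, ← map_mul, he]
  · refine Representation.IndV.hom_ext _ _ fun g => LinearMap.ext fun x => ?_
    have hx : rightIdealMk e x.1 = x := Subtype.ext (hmem x)
    exact (indV_mk_rightIdealMk φ e x.1 g).trans (by rw [hx]; rfl)
  · intro h
    refine Representation.IndV.hom_ext _ _ fun g => LinearMap.ext fun x => Subtype.ext ?_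
    change F₁ (Representation.ind φ ρ h (Representation.IndV.mk φ ρ g x)) =
      F₁ (Representation.IndV.mk φ ρ g x) * .single h⁻¹ 1
    rw [Representation.ind_mk, hF₁, hF₁, mul_assoc, MonoidAlgebra.single_mul_single, one_mul]

end Induction

/-! ### The reflection representation -/

theorem character_reflection {n : ℕ} (hn : 0 < n) (g : Perm (Fin n)) :
    (reflection n).character g = (Fintype.card {i // g i = i} : ℚ) - 1 := by
  let s : (Fin n → ℚ) →ₗ[ℚ] ℚ := ∑ i, LinearMap.proj i
  have hs : ∀ v, s v = ∑ i, v i := fun v => by simp [s]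
  -- The action of g followed by the projection along the constant vectors. Its image has coordinate
  -- sum 0, so its trace on ℚ^n is the wanted character, and the projection costs exactly 1.
  let f : (Fin n → ℚ) →ₗ[ℚ] (Fin n → ℚ) :=
    (LinearMap.id - (n : ℚ)⁻¹ • s.smulRight (1 : Fin n → ℚ)) ∘ₗ permRep n g
  have hf : ∀ v i, f v i = v (g⁻¹ i) - (n : ℚ)⁻¹ * ∑ j, v j := fun v i => by
    rw [← Equiv.sum_comp g⁻¹ v]
    simp [f, hs, permRep, LinearMap.funLeft]
  have hn' : (n : ℚ) ≠ 0 := by exact_mod_cast hn.ne'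
  have hmem : ∀ v, f v ∈ (reflectionSub n).toSubmodule := fun v => by
    change ∑ i, f v i = 0
    simp only [hf, Finset.sum_sub_distrib, Finset.sum_const, Finset.card_univ, Fintype.card_fin,
      nsmul_eq_mul]
    rw [Equiv.sum_comp g⁻¹ v]
    field_simp
    ring
  have h1 := LinearMap.trace_restrict_eq_of_forall_mem (reflectionSub n).toSubmodule f hmem
  have h2 : f.restrict (fun x _ => hmem x) = reflection n g := by
    refine LinearMap.ext fun v => Subtype.ext (funext fun i => ?_)
    have hv : ∑ j, v.1 j = 0 := v.2
    change f v.1 i = v.1 (g⁻¹ i)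
    rw [hf, hv, mul_zero, sub_zero]
  rw [h2] at h1
  rw [Representation.character, h1, LinearMap.trace_eq_matrix_trace ℚ (Pi.basisFun ℚ (Fin n)),
    Matrix.trace]
  simp only [Matrix.diag_apply, LinearMap.toMatrix_apply, Pi.basisFun_apply, Pi.basisFun_repr, hf,
    Finset.sum_sub_distrib, Finset.sum_const, Finset.card_univ, Fintype.card_fin, nsmul_eq_mul,
    Finset.sum_pi_single', Finset.mem_univ, if_true, mul_one]
  rw [mul_inv_cancel₀ hn', Fintype.card_subtype, Finset.card_filter]
  push_cast
  congr 1
  refine Finset.sum_congr rfl fun i _ => ?_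
  simp only [Pi.single_apply, Perm.inv_eq_iff_eq, eq_comm (a := g i)]

/-! ### Sorting permutations -/

section SortingPermutations

variable {n : ℕ} {α β : Type*} [LinearOrder α] [LinearOrder β]

/-- `Tuple.sort` is the stable sort, so it sorts positions strictly by the pair (letter, position).
-/
theorem eq_sort_iff_lt {f : Fin n → α} {w : Perm (Fin n)} :
    w = Tuple.sort f ↔
      ∀ i j, i < j → f (w i) < f (w j) ∨ f (w i) = f (w j) ∧ w i < w j := by
  rw [Tuple.eq_sort_iff]
  constructor
  · rintro ⟨h1, h2⟩ i j hij
    rcases (h1 hij.le).lt_or_eq with h | h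
    · exact .inl h
    · exact .inr ⟨h, h2 i j hij h⟩
  · intro h
    refine ⟨monotone_iff_forall_lt.2 fun i j hij => ?_, fun i j hij he => ?_⟩
    · rcases h i j hij with h | h
      exacts [h.le, h.1.le]
    · rcases h i j hij with h | h
      exacts [absurd he h.ne, h.2]

theorem sort_lt (f : Fin n → α) {i j : Fin n} (h : i < j) :
    f (Tuple.sort f i) < f (Tuple.sort f j) ∨
      f (Tuple.sort f i) = f (Tuple.sort f j) ∧ Tuple.sort f i < Tuple.sort f j :=
  eq_sort_iff_lt.1 rfl i j h

theorem sort_comp_strictMono (f : Fin n → α) {e : α → β} (he : StrictMono e) :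
    Tuple.sort (e ∘ f) = Tuple.sort f := by
  refine (eq_sort_iff_lt.2 fun i j hij => ?_).symm
  simpa [he.lt_iff_lt, he.injective.eq_iff] using sort_lt f hij

/-- The composite of two sorting permutations sorts lexicographically. -/
theorem sort_mul_sort (f : Fin n → α) (g : Fin n → β) :
    Tuple.sort f * Tuple.sort g =
      Tuple.sort fun x => toLex (g ((Tuple.sort f)⁻¹ x), f x) := by
  refine eq_sort_iff_lt.2 fun i j hij => ?_
  simp only [Perm.mul_apply, Perm.inv_def, Equiv.symm_apply_apply, Prod.Lex.toLex_lt_toLex, toLex_inj,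
    Prod.mk.injEq]
  rcases sort_lt g hij with h | ⟨h, h'⟩
  · exact .inl (.inl h)
  · rcases sort_lt f h' with h1 | h1
    · exact .inl (.inr ⟨h, h1⟩)
    · exact .inr ⟨⟨h, h1.1⟩, h1.2⟩

end SortingPermutations

/-- The sum of the sorting permutations of all words of length `n` in the alphabet `α`. -/
def sortSum (n : ℕ) (α : Type) [Fintype α] [LinearOrder α] : MonoidAlgebra ℚ (Perm (Fin n)) :=
  ∑ f : Fin n → α, MonoidAlgebra.single (Tuple.sort f) 1

/-! ### Sorting sums: multiplicativity and polynomial dependence on the alphabet size -/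

section SortSum

variable (n : ℕ) (α β : Type) [Fintype α] [LinearOrder α] [Fintype β] [LinearOrder β]

theorem sortSum_congr {α β : Type} [Fintype α] [LinearOrder α] [Fintype β] [LinearOrder β]
    (e : α ≃o β) : sortSum n α = sortSum n β :=
  Fintype.sum_equiv (Equiv.arrowCongr (Equiv.refl _) e.toEquiv) _ _ fun f =>
    congrArg (MonoidAlgebra.single · 1) (sort_comp_strictMono f e.strictMono).symm

/-- For fixed f, the word g ∘ (sort f)⁻¹ runs over all words along with g, so the products of
sorting permutations are those of all words of pairs. -/
theorem sortSum_mul_sortSum :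
    sortSum n α * sortSum n β = sortSum n (β ×ₗ α) := by
  rw [sortSum, sortSum, Finset.sum_mul_sum]
  have h : ∀ f : Fin n → α, ∑ g : Fin n → β,
      MonoidAlgebra.single (Tuple.sort f) (1 : ℚ) * MonoidAlgebra.single (Tuple.sort g) 1 =
      ∑ g : Fin n → β, MonoidAlgebra.single (Tuple.sort fun x => toLex (g x, f x)) 1 := fun f =>
    Fintype.sum_equiv (Equiv.arrowCongr (Tuple.sort f) (Equiv.refl _)) _ _ fun g => by
      rw [MonoidAlgebra.single_mul_single, mul_one, sort_mul_sort]
      rfl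
  rw [Finset.sum_congr rfl fun f _ => h f, Finset.sum_comm, ← Fintype.sum_prod_type']
  exact Fintype.sum_equiv ((Equiv.arrowProdEquivProdArrow (Fin n) (fun _ => β)
    (fun _ => α)).symm.trans (Equiv.arrowCongr (Equiv.refl _) toLex)) _ _ fun p => rfl

theorem sortSum_fin_mul (k l : ℕ) :
    sortSum n (Fin k) * sortSum n (Fin l) = sortSum n (Fin (k * l)) := by
  rw [sortSum_mul_sortSum]
  refine sortSum_congr n (Fintype.orderIsoFinOfCardEq (Fin l ×ₗ Fin k) ?_).symm
  rw [Fintype.card_lex, Fintype.card_prod, Fintype.card_fin, Fintype.card_fin, mul_comm]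

theorem sortSum_one : sortSum n (Fin 1) = 1 := by
  rw [sortSum, Fintype.sum_unique, MonoidAlgebra.one_def]
  congr 1
  exact Tuple.sort_eq_refl_iff_monotone.2 fun i j _ => (Subsingleton.elim _ _).le

/-- The sum of the sorting permutations of all words of length `n` in which all of the letters
`0, …, p - 1`, and no others, occur. -/
def surjSum (n p : ℕ) : MonoidAlgebra ℚ (Perm (Fin n)) :=
  ∑ f : Fin n → Fin p with Function.Surjective f, MonoidAlgebra.single (Tuple.sort f) 1

theorem surjSum_eq_zero_of_lt {n p : ℕ} (h : n < p) : surjSum n p = 0 := by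
  refine Finset.sum_eq_zero fun f hf => absurd (Finset.mem_filter.1 hf).2 fun hs => ?_
  have := Fintype.card_le_of_surjective f hs
  simp only [Fintype.card_fin] at this
  omega

theorem surjSum_zero {n : ℕ} (h : 0 < n) : surjSum n 0 = 0 :=
  Finset.sum_eq_zero fun f _ => (f ⟨0, h⟩).elim0

/-- Sorting sees only the relative order of the letters, so S may be relabelled increasingly by 0,
…, |S| - 1. -/
theorem sum_image_eq_surjSum (k : ℕ) (S : Finset (Fin k)) :
    ∑ f : Fin n → Fin k with Finset.univ.image f = S, MonoidAlgebra.single (Tuple.sort f) (1 : ℚ) =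
      surjSum n S.card := by
  symm
  refine Finset.sum_bij (fun g _ => S.orderEmbOfFin rfl ∘ g) ?_ ?_ ?_ ?_
  · intro g hg
    have hg := (Finset.mem_filter.1 hg).2
    simp only [Finset.mem_filter, Finset.mem_univ, true_and]
    rw [← Finset.image_image, Finset.image_univ_of_surjective hg]
    exact Finset.image_orderEmbOfFin_univ S rfl
  · intro g _ g' _ h
    exact (S.orderEmbOfFin rfl).injective.comp_left h
  · intro f hf
    have hf := (Finset.mem_filter.1 hf).2
    have hm : ∀ x, f x ∈ S := fun x => hf ▸ Finset.mem_image_of_mem f (Finset.mem_univ x)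
    refine ⟨fun x => (S.orderIsoOfFin rfl).symm ⟨f x, hm x⟩, ?_, ?_⟩
    · simp only [Finset.mem_filter, Finset.mem_univ, true_and]
      intro y
      have hy : (S.orderIsoOfFin rfl y).1 ∈ Finset.univ.image f := by
        rw [hf]
        exact (S.orderIsoOfFin rfl y).2
      obtain ⟨x, -, hx⟩ := Finset.mem_image.1 hy
      exact ⟨x, by rw [OrderIso.symm_apply_eq]; exact Subtype.ext hx⟩
    · funext x
      simp [← Finset.coe_orderIsoOfFin_apply]
  · intro g _
    rw [sort_comp_strictMono g (S.orderEmbOfFin rfl).strictMono]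

theorem sortSum_eq_sum_choose (k : ℕ) :
    sortSum n (Fin k) = ∑ p ∈ Finset.range (n + 1), (k.choose p) • surjSum n p := by
  have h1 : sortSum n (Fin k) = ∑ S : Finset (Fin k), surjSum n S.card := by
    rw [sortSum, ← Finset.sum_fiberwise _ fun f : Fin n → Fin k => Finset.univ.image f]
    exact Finset.sum_congr rfl fun S _ => sum_image_eq_surjSum n k S
  rw [h1, ← Finset.powerset_univ, Finset.sum_powerset_apply_card, Finset.card_univ,
    Fintype.card_fin]
  -- Both sums extend to a common range: the binomial vanishes for p > k, and `surjSum` for p > n.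
  rw [Finset.sum_subset (Finset.range_subset_range.2 (show k + 1 ≤ k + n + 1 by omega)),
    ← Finset.sum_subset (Finset.range_subset_range.2 (show n + 1 ≤ k + n + 1 by omega))]
  · intro p _ hp
    rw [surjSum_eq_zero_of_lt (by simpa using hp), smul_zero]
  · intro p _ hp
    rw [Nat.choose_eq_zero_of_lt (by simpa using hp), zero_smul]

/-- The coefficient of `k ^ j` in `sortSum n (Fin k)`. -/
def sortCoeff (n j : ℕ) : MonoidAlgebra ℚ (Perm (Fin n)) :=
  ∑ p ∈ Finset.range (n + 1), ((descPochhammer ℚ p).coeff j / p.factorial) • surjSum n p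

theorem sortSum_eq_sum_pow (k : ℕ) :
    sortSum n (Fin k) = ∑ j ∈ Finset.range (n + 1), ((k : ℚ) ^ j) • sortCoeff n j := by
  simp only [sortCoeff, Finset.smul_sum, smul_smul]
  rw [Finset.sum_comm, sortSum_eq_sum_choose]
  refine Finset.sum_congr rfl fun p hp => ?_
  rw [← Finset.sum_smul, ← Nat.cast_smul_eq_nsmul ℚ]
  congr 1
  rw [Nat.cast_choose_eq_descPochhammer_div ℚ, Polynomial.eval_eq_sum_range' (n := n + 1),
    Finset.sum_div]
  · exact Finset.sum_congr rfl fun j _ => by ring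
  · rw [descPochhammer_natDegree]
    simpa using hp

/-- This excludes the eigenvalue 2^0 of S_2. -/
theorem sortCoeff_zero {n : ℕ} (h : 0 < n) : sortCoeff n 0 = 0 := by
  refine Finset.sum_eq_zero fun p _ => ?_
  rcases Nat.eq_zero_or_pos p with rfl | hp
  · rw [surjSum_zero h, smul_zero]
  · rw [Polynomial.coeff_zero_eq_eval_zero, descPochhammer_ne_zero_eval_zero ℚ hp.ne', zero_div,
      zero_smul]

theorem eq_zero_of_forall_sum_pow_smul {G : Type} [Group G] (N : ℕ) (b : ℕ → MonoidAlgebra ℚ G)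
    (h : ∀ k : ℕ, ∑ j ∈ Finset.range N, ((k : ℚ) ^ j) • b j = 0) {j : ℕ} (hj : j < N) :
    b j = 0 := by
  ext g
  let P : Polynomial ℚ := ∑ j ∈ Finset.range N, Polynomial.monomial j ((b j).coeff g)
  have hP : P = 0 := by
    refine Polynomial.eq_zero_of_infinite_isRoot P (Set.Infinite.mono ?_
      (Set.infinite_range_of_injective (Nat.cast_injective (R := ℚ))))
    rintro _ ⟨k, rfl⟩
    have := congrArg (fun x => x.coeff g) (h k)
    simp only [MonoidAlgebra.coeff_sum, MonoidAlgebra.coeff_smul, Finsupp.finsetSum_apply,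
      Finsupp.smul_apply, smul_eq_mul, MonoidAlgebra.coeff_zero, Finsupp.zero_apply] at this
    simp [P, Polynomial.IsRoot, Polynomial.eval_finsetSum, ← this, mul_comm]
  have := congrArg (fun p => Polynomial.coeff p j) hP
  simpa [P, Polynomial.finsetSum_coeff, Polynomial.coeff_monomial, hj] using this

/-- Compare the coefficients of k^j in S_2 S_k = S_{2k}. -/
theorem sortSum_two_mul_sortCoeff {j : ℕ} (hj : j < n + 1) :
    sortSum n (Fin 2) * sortCoeff n j = ((2 : ℚ) ^ j) • sortCoeff n j := by
  refine sub_eq_zero.1 (eq_zero_of_forall_sum_pow_smul (n + 1) (fun j =>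
    sortSum n (Fin 2) * sortCoeff n j - ((2 : ℚ) ^ j) • sortCoeff n j) (fun k => ?_) hj)
  have h := sortSum_fin_mul n 2 k
  rw [sortSum_eq_sum_pow n k, sortSum_eq_sum_pow n (2 * k), Finset.mul_sum, ← sub_eq_zero,
    ← Finset.sum_sub_distrib] at h
  rw [← h]
  refine Finset.sum_congr rfl fun j _ => ?_
  rw [smul_sub, mul_smul_comm, smul_smul]
  push_cast
  rw [mul_pow, mul_comm]

/-- The eigenvalues of `sortSum n (Fin 2)` are `2, 4, …, 2 ^ n`, and it is diagonalizable. -/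
theorem aeval_sortSum_two_eq_zero {n : ℕ} (hn : 0 < n) {P : Polynomial ℚ}
    (hP : ∀ j ∈ Finset.Icc 1 n, P.eval (2 ^ j) = 0) :
    Polynomial.aeval (sortSum n (Fin 2)) P = 0 := by
  -- At k = 1 this decomposes the unit into eigenvectors of S_2.
  have h1 := sortSum_eq_sum_pow n 1
  rw [sortSum_one] at h1
  rw [← mul_one (Polynomial.aeval _ P), h1, Finset.mul_sum]
  refine Finset.sum_eq_zero fun j hj => ?_
  rw [Nat.cast_one, one_pow, one_smul]
  have hj := Finset.mem_range.1 hj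
  have key : ∀ Q : Polynomial ℚ, Polynomial.aeval (sortSum n (Fin 2)) Q * sortCoeff n j =
      Q.eval (2 ^ j) • sortCoeff n j := fun Q => by
    induction Q using Polynomial.induction_on' with
    | add p q hp hq => rw [map_add, add_mul, hp, hq, Polynomial.eval_add, add_smul]
    | monomial k a =>
      induction k with
      | zero => simp [Algebra.smul_def]
      | succ k ih =>
        rw [← Polynomial.monomial_mul_X, map_mul, Polynomial.aeval_X, mul_assoc,
          sortSum_two_mul_sortCoeff n hj, mul_smul_comm, ih, smul_smul, Polynomial.eval_mul_X,
          mul_comm]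
  rw [key]
  rcases Nat.eq_zero_or_pos j with rfl | hj0
  · rw [sortCoeff_zero hn, smul_zero]
  · rw [hP j (Finset.mem_Icc.2 ⟨hj0, by omega⟩), zero_smul]

end SortSum

/-! ### Binary words and the cyclic rotation -/

section Rotation

variable {m : ℕ}

theorem finRotate_castSucc (i : Fin m) : finRotate (m + 1) i.castSucc = i.succ := by
  rw [finRotate_apply, Fin.coeSucc_eq_succ]

theorem val_finRotate_pow (k : ℕ) (i : Fin (m + 1)) :
    ((finRotate (m + 1) ^ k) i : ℕ) = (i + k) % (m + 1) := by
  induction k with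
  | zero => simp [Nat.mod_eq_of_lt i.2]
  | succ k ih =>
    rw [pow_succ', Perm.mul_apply, finRotate_apply, Fin.val_add, ih, Fin.val_one']
    rw [← Nat.add_mod, add_assoc]

theorem finRotate_pow_self : finRotate (m + 1) ^ (m + 1) = 1 := by
  refine Equiv.ext fun i => Fin.ext ?_
  rw [val_finRotate_pow, Nat.add_mod_right, Nat.mod_eq_of_lt i.2, Perm.one_apply]

theorem incl_castSucc (w : Perm (Fin m)) (i : Fin m) :
    incl (m + 1) w i.castSucc = (w i).castSucc :=
  Perm.viaEmbedding_apply w (Fin.castLEEmb (Nat.sub_le (m + 1) 1)) i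

theorem incl_last (w : Perm (Fin m)) : incl (m + 1) w (Fin.last m) = Fin.last m := by
  refine Perm.viaEmbedding_apply_of_notMem w (Fin.castLEEmb (Nat.sub_le (m + 1) 1)) _ ?_
  rintro ⟨i, hi⟩
  exact (Fin.castSucc_lt_last i).ne hi

theorem sign_incl (w : Perm (Fin m)) : Perm.sign (incl (m + 1) w) = Perm.sign w := by
  change Perm.sign (Perm.viaEmbedding w _) = _
  rw [Perm.viaEmbedding]
  convert Perm.sign_extendDomain w _

theorem sort_snoc_one (f : Fin m → Fin 2) :
    Tuple.sort (Fin.snoc f 1 : Fin (m + 1) → Fin 2) = incl (m + 1) (Tuple.sort f) := by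
  refine (eq_sort_iff_lt.2 fun i j hij => ?_).symm
  induction i using Fin.lastCases with
  | last => exact absurd hij (Fin.le_last j).not_gt
  | cast i =>
  induction j using Fin.lastCases with
  | last =>
    rw [incl_castSucc, incl_last, Fin.snoc_castSucc, Fin.snoc_last]
    have := Fin.castSucc_lt_last (Tuple.sort f i)
    omega
  | cast j =>
    simp only [incl_castSucc, Fin.snoc_castSucc, Fin.castSucc_lt_castSucc_iff] at hij ⊢
    exact sort_lt f hij

theorem sort_cons_zero (f : Fin m → Fin 2) :
    Tuple.sort (Fin.cons 0 f : Fin (m + 1) → Fin 2) =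
      finRotate (m + 1) * incl (m + 1) (Tuple.sort f) * (finRotate (m + 1))⁻¹ := by
  have h0 : (finRotate (m + 1) * incl (m + 1) (Tuple.sort f) * (finRotate (m + 1))⁻¹) 0 = 0 := by
    rw [Perm.mul_apply, Perm.mul_apply, (Perm.inv_eq_iff_eq.2 finRotate_last.symm), incl_last,
      finRotate_last]
  have hs : ∀ i : Fin m, (finRotate (m + 1) * incl (m + 1) (Tuple.sort f) *
      (finRotate (m + 1))⁻¹) i.succ = (Tuple.sort f i).succ := fun i => by
    rw [Perm.mul_apply, Perm.mul_apply, (Perm.inv_eq_iff_eq.2 (finRotate_castSucc i).symm),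
      incl_castSucc, finRotate_castSucc]
  refine (eq_sort_iff_lt.2 fun i j hij => ?_).symm
  induction j using Fin.cases with
  | zero => exact absurd hij (Fin.zero_le i).not_gt
  | succ j =>
  induction i using Fin.cases with
  | zero =>
    rw [h0, hs, Fin.cons_zero, Fin.cons_succ]
    have := Fin.succ_pos (Tuple.sort f j)
    omega
  | succ i =>
    simp only [hs, Fin.cons_succ, Fin.succ_lt_succ_iff] at hij ⊢
    exact sort_lt f hij

/-- In the word 1f the initial 1 is sorted after all the 0s and before the other 1s; the final 0 of
f0 takes the same place. -/
theorem sort_cons_one (f : Fin m → Fin 2) :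
    Tuple.sort (Fin.cons 1 f : Fin (m + 1) → Fin 2) =
      finRotate (m + 1) * Tuple.sort (Fin.snoc f 0 : Fin (m + 1) → Fin 2) := by
  refine (eq_sort_iff_lt.2 fun i j hij => ?_).symm
  have h := sort_lt (Fin.snoc f 0 : Fin (m + 1) → Fin 2) hij
  rw [Perm.mul_apply, Perm.mul_apply]
  generalize Tuple.sort (Fin.snoc f 0 : Fin (m + 1) → Fin 2) i = x at h
  generalize Tuple.sort (Fin.snoc f 0 : Fin (m + 1) → Fin 2) j = y at h
  induction x using Fin.lastCases with
  | last =>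
    induction y using Fin.lastCases with
    | last => simp at h
    | cast y =>
      rw [Fin.snoc_last, Fin.snoc_castSucc] at h
      rw [finRotate_last, finRotate_castSucc, Fin.cons_zero, Fin.cons_succ]
      have := Fin.succ_pos y
      have := Fin.castSucc_lt_last y
      omega
  | cast x =>
    induction y using Fin.lastCases with
    | last =>
      rw [Fin.snoc_last, Fin.snoc_castSucc] at h
      rw [finRotate_last, finRotate_castSucc, Fin.cons_zero, Fin.cons_succ]
      omega
    | cast y =>
      simp only [Fin.snoc_castSucc, finRotate_castSucc, Fin.cons_succ, Fin.succ_lt_succ_iff,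
        Fin.castSucc_lt_castSucc_iff] at h ⊢
      exact h

/-- The sorting permutation of a decreasing binary word is a power of the cyclic rotation. -/
theorem exists_sort_eq_finRotate_pow (g : Fin (m + 1) → Fin 2) (hg : Antitone g) :
    ∃ k, Tuple.sort g = finRotate (m + 1) ^ k := by
  -- A decreasing word consists of z ones followed by zeros, so sorting it is the shift by z.
  let z := (Finset.univ.filter fun i => 0 < g i).card
  have hz : ∀ j : Fin (m + 1), (j : ℕ) < z ↔ 0 < g j := fun j =>
    Tuple.lt_card_gt_iff_apply_gt_of_antitone (f := g) (a := 0) hg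
  have hzm : z ≤ m + 1 := (Finset.card_le_univ _).trans (by simp)
  refine ⟨z, (eq_sort_iff_lt.2 fun i j hij => ?_).symm⟩
  have hval : ∀ i : Fin (m + 1), ((finRotate (m + 1) ^ z) i : ℕ) =
      if (i : ℕ) + z < m + 1 then (i : ℕ) + z else i + z - (m + 1) := fun i => by
    rw [val_finRotate_pow]
    split_ifs with h
    · exact Nat.mod_eq_of_lt h
    · rw [Nat.mod_eq_sub_mod (not_lt.1 h), Nat.mod_eq_of_lt (by omega)]
  have hi := hval i
  have hj := hval j
  have hgi := hz ((finRotate (m + 1) ^ z) i)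
  have hgj := hz ((finRotate (m + 1) ^ z) j)
  rw [hi] at hgi
  rw [hj] at hgj
  rw [Fin.lt_def (a := (finRotate (m + 1) ^ z) i), hi, hj]
  have hij' : (i : ℕ) < j := hij
  have := j.2
  split_ifs at * <;> omega

/-- Reversing the alphabet of a binary word rotates its sorting permutation. -/
theorem exists_sort_rev (f : Fin (m + 1) → Fin 2) :
    ∃ k, Tuple.sort (Fin.rev ∘ f) = Tuple.sort f * finRotate (m + 1) ^ k := by
  -- Sorting f first and then reversing the alphabet leaves a decreasing word, which a rotation
  -- sorts.
  obtain ⟨k, hk⟩ := exists_sort_eq_finRotate_pow (Fin.rev ∘ f ∘ Tuple.sort f) fun i j hij =>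
    Fin.rev_le_rev.2 (Tuple.monotone_sort f hij)
  refine ⟨k, ?_⟩
  rw [← hk, sort_mul_sort]
  refine eq_sort_iff_lt.2 fun i j hij => ?_
  have h := sort_lt (Fin.rev ∘ f) hij
  simp only [Function.comp_apply, Perm.inv_def, Equiv.apply_symm_apply, Prod.Lex.toLex_lt_toLex,
    toLex_inj, Prod.mk.injEq, Fin.rev_inj, Fin.rev_lt_rev] at h ⊢
  rcases h with h | h
  · exact .inl (.inl h)
  · exact .inr ⟨⟨h.1, h.1⟩, h.2⟩

theorem exists_sort_snoc_zero (f : Fin m → Fin 2) :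
    ∃ k, incl (m + 1) (Tuple.sort (Fin.rev ∘ f)) =
      Tuple.sort (Fin.snoc f 0 : Fin (m + 1) → Fin 2) * finRotate (m + 1) ^ k := by
  obtain ⟨k, hk⟩ := exists_sort_rev (Fin.snoc f 0 : Fin (m + 1) → Fin 2)
  refine ⟨k, ?_⟩
  rw [← hk, ← sort_snoc_one]
  congr 1
  funext i
  induction i using Fin.lastCases with
  | last => simp
  | cast i => simp

end Rotation

/-! ### The relations between the shuffle elements and the cyclic rotation -/

section Relations

variable (m : ℕ)

/-- The cyclic rotation in the group algebra. -/
def rot : MonoidAlgebra ℚ (Perm (Fin (m + 1))) := .single (finRotate (m + 1)) 1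

/-- The inverse cyclic rotation in the group algebra. -/
def rotInv : MonoidAlgebra ℚ (Perm (Fin (m + 1))) := .single (finRotate (m + 1))⁻¹ 1

theorem rot_mul_rotInv : rot m * rotInv m = 1 := by
  simp [rot, rotInv, MonoidAlgebra.single_mul_single, MonoidAlgebra.one_def]

theorem rotInv_mul_rot : rotInv m * rot m = 1 := by
  simp [rot, rotInv, MonoidAlgebra.single_mul_single, MonoidAlgebra.one_def]

theorem rot_pow (k : ℕ) : rot m ^ k = .single (finRotate (m + 1) ^ k) 1 := by
  rw [rot, MonoidAlgebra.single_pow, one_pow]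

theorem rot_pow_self : rot m ^ (m + 1) = 1 := by
  rw [rot_pow, finRotate_pow_self, MonoidAlgebra.one_def]

/-- The sum of the powers of the cyclic rotation. -/
def rotSum : MonoidAlgebra ℚ (Perm (Fin (m + 1))) := ∑ i ∈ Finset.range (m + 1), rot m ^ i

theorem rot_mul_rotSum : rot m * rotSum m = rotSum m := by
  have h := mul_geom_sum (rot m) (m + 1)
  rw [rot_pow_self, sub_self, sub_mul, one_mul, sub_eq_zero] at h
  exact h

theorem rotSum_mul_rot : rotSum m * rot m = rotSum m := by
  have h := geom_sum_mul (rot m) (m + 1)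
  rw [rot_pow_self, sub_self, mul_sub, mul_one, sub_eq_zero] at h
  exact h

theorem rot_pow_mul_rotSum (k : ℕ) : rot m ^ k * rotSum m = rotSum m := by
  induction k with
  | zero => rw [pow_zero, one_mul]
  | succ k ih => rw [pow_succ, mul_assoc, rot_mul_rotSum, ih]

/-- The sum of the sorting permutations of the binary words of length `m`, in the group algebra
of the permutations of `m + 1` letters. -/
def inclSortSum : MonoidAlgebra ℚ (Perm (Fin (m + 1))) :=
  algMap (incl (m + 1)) (sortSum m (Fin 2))

theorem inclSortSum_eq : inclSortSum m =
    ∑ f : Fin m → Fin 2, .single (incl (m + 1) (Tuple.sort f)) 1 := by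
  rw [inclSortSum, sortSum, map_sum]
  exact Finset.sum_congr rfl fun f _ => by simp

/-- The sum of the sorting permutations of the binary words ending in `0`. -/
def snocZeroSum : MonoidAlgebra ℚ (Perm (Fin (m + 1))) :=
  ∑ f : Fin m → Fin 2, .single (Tuple.sort (Fin.snoc f 0 : Fin (m + 1) → Fin 2)) 1

theorem sortSum_eq_snoc : sortSum (m + 1) (Fin 2) = snocZeroSum m + inclSortSum m := by
  rw [sortSum, ← (Fin.snocEquiv fun _ : Fin (m + 1) => Fin 2).sum_comp, Fintype.sum_prod_type,
    Fin.sum_univ_two, snocZeroSum, inclSortSum_eq]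
  congr 1
  exact Finset.sum_congr rfl fun f _ => by rw [← sort_snoc_one]; rfl

theorem sortSum_eq_cons :
    sortSum (m + 1) (Fin 2) = rot m * inclSortSum m * rotInv m + rot m * snocZeroSum m := by
  rw [sortSum, ← (Fin.consEquiv fun _ : Fin (m + 1) => Fin 2).sum_comp, Fintype.sum_prod_type,
    Fin.sum_univ_two, snocZeroSum, inclSortSum_eq, Finset.mul_sum, Finset.sum_mul,
    Finset.mul_sum]
  congr 1
  · refine Finset.sum_congr rfl fun f _ => ?_
    rw [rot, rotInv, MonoidAlgebra.single_mul_single, MonoidAlgebra.single_mul_single, one_mul,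
      one_mul, ← sort_cons_zero]
    rfl
  · refine Finset.sum_congr rfl fun f _ => ?_
    rw [rot, MonoidAlgebra.single_mul_single, one_mul, ← sort_cons_one]
    rfl

/-- With a = `inclSortSum m` and Z = `snocZeroSum m`, the last letter gives S = Z + a and the first
gives c⁻¹S = a c⁻¹ + Z; the term Z cancels. -/
theorem one_sub_rotInv_mul_sortSum :
    (1 - rotInv m) * sortSum (m + 1) (Fin 2) = inclSortSum m * (1 - rotInv m) := by
  have h : rotInv m * sortSum (m + 1) (Fin 2) = inclSortSum m * rotInv m + snocZeroSum m := by
    rw [sortSum_eq_cons, mul_add, mul_assoc (rot m), ← mul_assoc (rotInv m), rotInv_mul_rot,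
      one_mul, ← mul_assoc (rotInv m), rotInv_mul_rot, one_mul]
  rw [sub_mul, h, one_mul, sortSum_eq_snoc, mul_sub, mul_one]
  abel

/-- Reversing the alphabet turns f0 into a word ending in 1, at the cost of a right rotation, which
the rotation sum absorbs. -/
theorem snocZeroSum_mul_rotSum : snocZeroSum m * rotSum m = inclSortSum m * rotSum m := by
  rw [snocZeroSum, inclSortSum_eq, Finset.sum_mul, Finset.sum_mul]
  refine Fintype.sum_equiv (Equiv.arrowCongr (Equiv.refl _) Fin.revPerm) _ _ fun f => ?_
  obtain ⟨k, hk⟩ := exists_sort_snoc_zero f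
  change _ = MonoidAlgebra.single (incl (m + 1) (Tuple.sort (Fin.rev ∘ f))) 1 * rotSum m
  rw [hk, ← one_mul (1 : ℚ), ← MonoidAlgebra.single_mul_single, mul_assoc, ← rot_pow,
    rot_pow_mul_rotSum, one_mul]

/-- Since S = Z + a, SC = 2aC. By the difference relation SC is rotation-invariant on the left and
Ca on the right, so CSC equals both (m + 1) SC and 2(m + 1) Ca. -/
theorem sortSum_mul_rotSum :
    sortSum (m + 1) (Fin 2) * rotSum m = (2 : ℚ) • (rotSum m * inclSortSum m) := by
  set s := sortSum (m + 1) (Fin 2)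
  set C := rotSum m
  set a := inclSortSum m
  have hm : ((m : ℚ) + 1) ≠ 0 := by positivity
  have hd : (1 - rotInv m) * s = a * (1 - rotInv m) := one_sub_rotInv_mul_sortSum m
  have hinv : rotInv m * C = C := by
    rw [← congrArg (rotInv m * ·) (rot_mul_rotSum m), ← mul_assoc, rotInv_mul_rot, one_mul]
  have hinv' : C * rotInv m = C := by
    rw [← congrArg (· * rotInv m) (rotSum_mul_rot m), mul_assoc, rot_mul_rotInv, mul_one]
  have hpow : ∀ x, rot m * x = x → C * x = ((m : ℚ) + 1) • x := fun x hx => by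
    have : ∀ i, rot m ^ i * x = x := fun i => by
      induction i with
      | zero => rw [pow_zero, one_mul]
      | succ i ih => rw [pow_succ, mul_assoc, hx, ih]
    simp only [C, rotSum, Finset.sum_mul, this, Finset.sum_const, Finset.card_range]
    rw [← Nat.cast_smul_eq_nsmul ℚ]
    push_cast
    rfl
  have hpow' : ∀ x, x * rot m = x → x * C = ((m : ℚ) + 1) • x := fun x hx => by
    have : ∀ i, x * rot m ^ i = x := fun i => by
      induction i with
      | zero => rw [pow_zero, mul_one]
      | succ i ih => rw [pow_succ', ← mul_assoc, hx, ih]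
    simp only [C, rotSum, Finset.mul_sum, this, Finset.sum_const, Finset.card_range]
    rw [← Nat.cast_smul_eq_nsmul ℚ]
    push_cast
    rfl
  have h1 : rot m * (s * C) = s * C := by
    have h : (1 - rotInv m) * (s * C) = 0 := by
      rw [← mul_assoc, hd, mul_assoc, sub_mul, one_mul, hinv, sub_self, mul_zero]
    rw [sub_mul, one_mul, sub_eq_zero] at h
    rw [h, ← mul_assoc, rot_mul_rotInv, one_mul]
    exact h
  have h2 : C * a * rot m = C * a := by
    have h : C * a * (1 - rotInv m) = 0 := by
      rw [mul_assoc, ← hd, ← mul_assoc, mul_sub, mul_one, hinv', sub_self, zero_mul]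
    rw [mul_sub, mul_one, sub_eq_zero] at h
    rw [h, mul_assoc, rotInv_mul_rot, mul_one]
    exact h
  have h3 : s * C = (2 : ℚ) • (a * C) := by
    rw [two_smul]
    simp only [s, C, a]
    rw [sortSum_eq_snoc, add_mul, snocZeroSum_mul_rotSum]
  have h4 := hpow _ h1
  rw [h3, mul_smul_comm, ← mul_assoc, hpow' _ h2, smul_comm, ← h3] at h4
  exact (smul_right_injective _ hm h4).symm

end Relations

/-! ### The twist by the sign character -/

section SignTwist

/-- The automorphism `w ↦ sgn(w) w` of the group algebra of a symmetric group. -/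
def signTwist (n : ℕ) : MonoidAlgebra ℚ (Perm (Fin n)) →ₐ[ℚ] MonoidAlgebra ℚ (Perm (Fin n)) :=
  MonoidAlgebra.lift ℚ _ _
    { toFun := fun w => .single w ((Perm.sign w : ℤ) : ℚ)
      map_one' := by simp [MonoidAlgebra.one_def]
      map_mul' := fun v w => by simp [MonoidAlgebra.single_mul_single] }

theorem signTwist_single {n : ℕ} (w : Perm (Fin n)) :
    signTwist n (.single w 1) = .single w ((Perm.sign w : ℤ) : ℚ) := by
  rw [signTwist, MonoidAlgebra.lift_single, one_smul]
  rfl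

theorem signTwist_algMap_incl (m : ℕ) (x : MonoidAlgebra ℚ (Perm (Fin m))) :
    signTwist (m + 1) (algMap (incl (m + 1)) x) = algMap (incl (m + 1)) (signTwist m x) := by
  induction x using MonoidAlgebra.induction_linear with
  | zero => simp only [map_zero]
  | add x y hx hy => simp only [map_add, hx, hy]
  | single w r =>
    rw [← mul_one r, ← smul_eq_mul, ← MonoidAlgebra.smul_single]
    simp only [map_smul, signTwist_single]
    congr 1
    change signTwist (m + 1) (MonoidAlgebra.mapDomain (incl (m + 1)) (.single w 1)) =
      MonoidAlgebra.mapDomain (incl (m + 1)) (.single w _)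
    rw [MonoidAlgebra.mapDomain_single, MonoidAlgebra.mapDomain_single, signTwist_single,
      sign_incl]

theorem cyc_eq_signTwist (m : ℕ) : cyc (m + 1) = signTwist (m + 1) (rotSum m) := by
  rw [cyc, rotSum, map_sum]
  refine Finset.sum_congr rfl fun i _ => ?_
  rw [rot_pow, signTwist_single]
  simp

/-- The condition on `w` defining the summands of the shuffle element `s_{i,n-i}`. -/
def IsShuffle {n : ℕ} (i : ℕ) (w : Perm (Fin n)) : Prop :=
  ∀ a b : Fin n, a < b → ((b : ℕ) < i ∨ i ≤ (a : ℕ)) → w a < w b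

theorem lt_card_filter_eq_zero_iff {n : ℕ} (f : Fin n → Fin 2) (j : Fin n) :
    (j : ℕ) < (Finset.univ.filter fun x => f x = 0).card ↔ f (Tuple.sort f j) = 0 := by
  have hcard : (Finset.univ.filter fun x => f x = 0).card =
      (Finset.univ.filter fun x => (f ∘ Tuple.sort f) x ≤ 0).card := by
    refine (Finset.card_bij (fun x _ => Tuple.sort f x) ?_ ?_ ?_).symm
    · intro x hx
      simpa using hx
    · intro x _ y _ h
      exact (Tuple.sort f).injective h
    · intro y hy
      exact ⟨(Tuple.sort f).symm y, by simpa using hy, by simp⟩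
  rw [hcard, ← Fin.le_zero_iff]
  exact Tuple.lt_card_le_iff_apply_le_of_monotone (Tuple.monotone_sort f)

theorem isShuffle_sort {n : ℕ} (f : Fin n → Fin 2) :
    IsShuffle (Finset.univ.filter fun x => f x = 0).card (Tuple.sort f) := by
  intro a b hab h
  have ha := lt_card_filter_eq_zero_iff f a
  have hb := lt_card_filter_eq_zero_iff f b
  have h1 := sort_lt f hab
  omega

theorem sort_of_isShuffle {n i : ℕ} {w : Perm (Fin n)} (hw : IsShuffle i w) :
    Tuple.sort (fun x => if ((w⁻¹ x : Fin n) : ℕ) < i then (0 : Fin 2) else 1) = w := by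
  refine (eq_sort_iff_lt.2 fun a b hab => ?_).symm
  have h := hw a b hab
  have hab' : (a : ℕ) < b := hab
  simp only [Perm.inv_def, Equiv.symm_apply_apply]
  split_ifs with h1 h2 h2
  · exact .inr ⟨rfl, h (.inl h2)⟩
  · exact .inl (by decide)
  · omega
  · exact .inr ⟨rfl, h (.inr (by omega))⟩

theorem card_of_lt {n i : ℕ} (hi : i ≤ n) (w : Perm (Fin n)) :
    (Finset.univ.filter fun x =>
      (if ((w⁻¹ x : Fin n) : ℕ) < i then (0 : Fin 2) else 1) = 0).card = i := by
  have : (Finset.univ.filter fun x =>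
      (if ((w⁻¹ x : Fin n) : ℕ) < i then (0 : Fin 2) else 1) = 0) =
      (Finset.univ.filter fun x : Fin n => (x : ℕ) < i).map w.toEmbedding := by
    ext x
    simp [Perm.inv_def]
  rw [this, Finset.card_map, Fin.card_filter_val_lt, min_eq_right hi]

/-- A shuffle w with cut i sorts exactly one binary word with i zeros: the one whose zeros sit at
w_1, …, w_i. -/
theorem sum_eq_shuffle {n i : ℕ} (hi : i ≤ n) :
    ∑ f : Fin n → Fin 2 with (Finset.univ.filter fun x => f x = 0).card = i,
      MonoidAlgebra.single (Tuple.sort f) ((Perm.sign (Tuple.sort f) : ℤ) : ℚ) = shuffle n i := by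
  rw [shuffle]
  symm
  refine Finset.sum_bij
    (fun w _ x => if ((w⁻¹ x : Fin n) : ℕ) < i then (0 : Fin 2) else 1) ?_ ?_ ?_ ?_
  · intro w _
    exact Finset.mem_filter.2 ⟨Finset.mem_univ _, card_of_lt hi w⟩
  · intro w hw w' hw' h
    rw [← sort_of_isShuffle (Finset.mem_filter.1 hw).2, h,
      sort_of_isShuffle (Finset.mem_filter.1 hw').2]
  · intro f hf
    have hf := (Finset.mem_filter.1 hf).2
    have hs := isShuffle_sort f
    rw [hf] at hs
    refine ⟨Tuple.sort f, Finset.mem_filter.2 ⟨Finset.mem_univ _, hs⟩, funext fun x => ?_⟩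
    obtain ⟨y, rfl⟩ := (Tuple.sort f).surjective x
    have hy := lt_card_filter_eq_zero_iff f y
    rw [hf] at hy
    simp only [Perm.inv_def, Equiv.symm_apply_apply]
    split_ifs with h
    · exact (hy.1 h).symm
    · have := mt hy.2 h
      omega
  · intro w hw
    rw [sort_of_isShuffle (Finset.mem_filter.1 hw).2]

theorem shuffle_eq_one {n i : ℕ} (hi : i = 0 ∨ i = n) : shuffle n i = 1 := by
  have : (Finset.univ.filter fun w : Perm (Fin n) =>
      ∀ a b : Fin n, a < b → ((b : ℕ) < i ∨ i ≤ (a : ℕ)) → w a < w b) = {1} := by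
    ext w
    simp only [Finset.mem_filter, Finset.mem_univ, true_and, Finset.mem_singleton]
    constructor
    · intro h
      refine (Perm.monotone_iff w).1 (StrictMono.monotone fun a b hab => h a b hab ?_)
      have := b.2
      omega
    · rintro rfl a b hab _
      exact hab
  rw [shuffle, this, Finset.sum_singleton, Perm.sign_one, MonoidAlgebra.one_def]
  simp

/-- The constant 2 is the contribution of the constant words, which correspond to the cuts 0 and n;
these are distinct as n > 0. -/
theorem signTwist_sortSum {n : ℕ} (hn : 0 < n) :
    signTwist n (sortSum n (Fin 2)) = totalShuffle n + 2 := by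
  have hr : Finset.range (n + 1) = insert 0 (insert n (Finset.Ico 1 n)) := by
    ext i
    simp only [Finset.mem_range, Finset.mem_insert, Finset.mem_Ico]
    omega
  have hsum : signTwist n (sortSum n (Fin 2)) = ∑ i ∈ Finset.range (n + 1), shuffle n i := by
    rw [sortSum, map_sum, ← Finset.sum_fiberwise_of_maps_to (s := Finset.univ)
      (t := Finset.range (n + 1))
      (g := fun f : Fin n → Fin 2 => (Finset.univ.filter fun x => f x = 0).card)
      (fun f _ => Finset.mem_range.2
        (Nat.lt_succ_of_le ((Finset.card_le_univ _).trans (Fintype.card_fin n).le)))]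
    refine Finset.sum_congr rfl fun i hi => ?_
    rw [← sum_eq_shuffle (Nat.lt_succ_iff.1 (Finset.mem_range.1 hi))]
    exact Finset.sum_congr rfl fun f _ => signTwist_single _
  rw [hsum, hr, Finset.sum_insert, Finset.sum_insert, shuffle_eq_one (.inl rfl),
    shuffle_eq_one (.inr rfl), totalShuffle, ← add_assoc, one_add_one_eq_two, add_comm]
  · simp
  · simp only [Finset.mem_insert, Finset.mem_Ico]
    omega

end SignTwist

/-! ### Eulerian idempotents -/

section Eulerian

theorem totalShuffle_eq {n : ℕ} (hn : 0 < n) :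
    totalShuffle n = signTwist n (sortSum n (Fin 2) - 2) := by
  rw [map_sub, signTwist_sortSum hn, map_ofNat, add_sub_cancel_right]

theorem aeval_totalShuffle_eq_zero {n : ℕ} (hn : 0 < n) {P : Polynomial ℚ}
    (hP : ∀ j ∈ Finset.Icc 1 n, P.eval (2 ^ j - 2) = 0) :
    Polynomial.aeval (totalShuffle n) P = 0 := by
  have h := aeval_sortSum_two_eq_zero hn (P := P.comp (Polynomial.X - 2)) fun j hj => by
    rw [Polynomial.eval_comp, Polynomial.eval_sub, Polynomial.eval_X, Polynomial.eval_ofNat, hP j hj]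
  rw [Polynomial.aeval_comp, map_sub, Polynomial.aeval_X, map_ofNat] at h
  rw [totalShuffle_eq hn, Polynomial.aeval_algHom_apply, h, map_zero]

theorem aeval_totalShuffle_congr {n : ℕ} (hn : 0 < n) {P Q : Polynomial ℚ}
    (h : ∀ j ∈ Finset.Icc 1 n, P.eval (2 ^ j - 2) = Q.eval (2 ^ j - 2)) :
    Polynomial.aeval (totalShuffle n) P = Polynomial.aeval (totalShuffle n) Q := by
  rw [← sub_eq_zero, ← map_sub]
  exact aeval_totalShuffle_eq_zero hn fun j hj => by rw [Polynomial.eval_sub, h j hj, sub_self]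

/-- The interpolation polynomial defining the `j`-th Eulerian idempotent. -/
abbrev eulerianPoly (n j : ℕ) : Polynomial ℚ :=
  Lagrange.basis (Finset.Icc 1 n) (fun i : ℕ => (2 : ℚ) ^ i - 2) j

theorem eval_eulerianPoly {n i : ℕ} (j : ℕ) (hi : i ∈ Finset.Icc 1 n) :
    (eulerianPoly n j).eval (2 ^ i - 2) = if i = j then 1 else 0 := by
  split_ifs with h
  · subst h
    refine Lagrange.eval_basis_self (v := fun i : ℕ => (2 : ℚ) ^ i - 2) (fun a _ b _ hab => ?_) hi
    have hab : (2 : ℚ) ^ a = 2 ^ b := sub_left_injective hab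
    exact Nat.pow_right_injective le_rfl (by exact_mod_cast hab)
  · exact Lagrange.eval_basis_of_ne (v := fun i : ℕ => (2 : ℚ) ^ i - 2) (Ne.symm h) hi

theorem eulerianIdem_mul_self {n : ℕ} (hn : 0 < n) (j : ℕ) :
    eulerianIdem n j * eulerianIdem n j = eulerianIdem n j := by
  rw [eulerianIdem, ← map_mul]
  refine aeval_totalShuffle_congr hn fun i hi => ?_
  rw [Polynomial.eval_mul, eval_eulerianPoly j hi]
  simp

/-- Outside 1, …, n the interpolation formula still vanishes at every eigenvalue, so the recursions
below hold at the boundary indices. -/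
theorem eulerianIdem_eq_zero {n j : ℕ} (hn : 0 < n) (hj : j ∉ Finset.Icc 1 n) :
    eulerianIdem n j = 0 :=
  aeval_totalShuffle_eq_zero hn fun i hi => by
    rw [eval_eulerianPoly j hi, if_neg]
    rintro rfl
    exact hj hi

/-- Intertwining of two elements passes to polynomials in them. -/
theorem mul_aeval_of_mul_eq {A : Type*} [Ring A] [Algebra ℚ A] {x y z : A} (h : z * x = y * z)
    (P : Polynomial ℚ) : z * Polynomial.aeval x P = Polynomial.aeval y P * z := by
  induction P using Polynomial.induction_on' with
  | add p q hp hq => rw [map_add, map_add, mul_add, add_mul, hp, hq]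
  | monomial k a =>
    induction k with
    | zero => simp [Algebra.commutes]
    | succ k ih =>
      rw [← Polynomial.monomial_mul_X, map_mul, map_mul, Polynomial.aeval_X, Polynomial.aeval_X,
        ← mul_assoc, ih, mul_assoc, h, mul_assoc]

variable {m : ℕ}

/-- The Eulerian idempotents of the symmetric group on `m` letters, in the group algebra of the
symmetric group on `m + 1` letters. -/
abbrev inclIdem (m j : ℕ) : MonoidAlgebra ℚ (Perm (Fin (m + 1))) :=
  algMap (incl (m + 1)) (eulerianIdem m j)

/-- The difference `1 - sgn(c) c⁻¹` for the cyclic rotation `c`. -/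
def cycDiff (m : ℕ) : MonoidAlgebra ℚ (Perm (Fin (m + 1))) := signTwist (m + 1) (1 - rotInv m)

theorem signTwist_inclSortSum (hm : 0 < m) :
    signTwist (m + 1) (inclSortSum m) = algMap (incl (m + 1)) (totalShuffle m) + 2 := by
  rw [inclSortSum, signTwist_algMap_incl, signTwist_sortSum hm, map_add, map_ofNat]

theorem cycDiff_mul_totalShuffle (hm : 0 < m) :
    cycDiff m * totalShuffle (m + 1) = algMap (incl (m + 1)) (totalShuffle m) * cycDiff m := by
  have h := congrArg (signTwist (m + 1)) (one_sub_rotInv_mul_sortSum m)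
  rw [map_mul, map_mul, signTwist_sortSum m.succ_pos, signTwist_inclSortSum hm, mul_add,
    add_mul, mul_two, two_mul] at h
  exact add_right_cancel h

theorem cyc_mul_incl_totalShuffle (hm : 0 < m) :
    cyc (m + 1) * (2 * algMap (incl (m + 1)) (totalShuffle m) + 2) =
      totalShuffle (m + 1) * cyc (m + 1) := by
  have h := congrArg (signTwist (m + 1)) (sortSum_mul_rotSum m)
  rw [map_mul, map_smul, map_mul, signTwist_sortSum m.succ_pos, signTwist_inclSortSum hm,
    ← cyc_eq_signTwist, two_smul] at h
  have h2 : totalShuffle (m + 1) * cyc (m + 1) =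
    (totalShuffle (m + 1) + 2) * cyc (m + 1) - 2 * cyc (m + 1) := by rw [add_mul]; abel
  rw [h2, h]
  noncomm_ring

theorem cycDiff_mul_eulerianIdem (hm : 0 < m) (j : ℕ) :
    cycDiff m * eulerianIdem (m + 1) j = inclIdem m j * cycDiff m := by
  rw [eulerianIdem, mul_aeval_of_mul_eq (cycDiff_mul_totalShuffle hm),
    Polynomial.aeval_algHom_apply, inclIdem, eulerianIdem,
    aeval_totalShuffle_congr hm (Q := eulerianPoly m j) fun i hi => ?_]
  rw [eval_eulerianPoly j hi, eval_eulerianPoly j (Finset.Icc_subset_Icc_right m.le_succ hi)]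

/-- The index shifts because x ↦ 2x + 2 sends 2^i - 2 to 2^{i+1} - 2. -/
theorem cyc_mul_inclIdem (hm : 0 < m) (j : ℕ) :
    cyc (m + 1) * inclIdem m j = eulerianIdem (m + 1) (j + 1) * cyc (m + 1) := by
  rw [eulerianIdem, ← mul_aeval_of_mul_eq (cyc_mul_incl_totalShuffle hm)]
  have h : (2 * algMap (incl (m + 1)) (totalShuffle m) + 2) =
      Polynomial.aeval (algMap (incl (m + 1)) (totalShuffle m)) (2 * Polynomial.X + 2 :
        Polynomial ℚ) := by
    rw [map_add, map_mul, Polynomial.aeval_X, map_ofNat]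
  rw [h, ← Polynomial.aeval_comp, Polynomial.aeval_algHom_apply, inclIdem, eulerianIdem,
    aeval_totalShuffle_congr hm fun i hi => ?_]
  have hi' : i + 1 ∈ Finset.Icc 1 (m + 1) := by
    simp only [Finset.mem_Icc] at hi ⊢
    omega
  have h2 := eval_eulerianPoly (j + 1) hi'
  rw [eval_eulerianPoly j hi, Polynomial.eval_comp]
  simp only [Polynomial.eval_add, Polynomial.eval_mul, Polynomial.eval_ofNat, Polynomial.eval_X,
    add_left_inj] at h2 ⊢
  rw [← h2, pow_succ]
  congr 1
  ring

end Eulerian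

/-! ### The characters of the lifts -/

section Lifts

variable {m : ℕ}

/-- Each 1 - c^i is divisible by 1 - c⁻¹; the quotient q is a polynomial in c, so it commutes with
that factor. -/
theorem exists_sub_rotSum_eq (m : ℕ) : ∃ q : MonoidAlgebra ℚ (Perm (Fin (m + 1))),
    q * (1 - rotInv m) = ((m + 1 : ℕ) : MonoidAlgebra ℚ (Perm (Fin (m + 1)))) - rotSum m ∧
    (1 - rotInv m) * q = ((m + 1 : ℕ) : MonoidAlgebra ℚ (Perm (Fin (m + 1)))) - rotSum m := by
  have hterm : ∀ i, (∑ k ∈ Finset.range i, rot m ^ k) * rot m * (1 - rotInv m) =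
      rot m ^ i - 1 := fun i => by
    rw [mul_sub, mul_assoc _ (rot m) (rotInv m), rot_mul_rotInv, mul_assoc, mul_one (rot m),
      ← mul_sub, geom_sum_mul]
  have hq : (-∑ i ∈ Finset.range (m + 1), (∑ k ∈ Finset.range i, rot m ^ k) * rot m) *
      (1 - rotInv m) =
        ((m + 1 : ℕ) : MonoidAlgebra ℚ (Perm (Fin (m + 1)))) - rotSum m := by
    rw [neg_mul, Finset.sum_mul, Finset.sum_congr rfl fun i _ => hterm i, Finset.sum_sub_distrib,
      neg_sub, Finset.sum_const, Finset.card_range, nsmul_one, rotSum]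
  have hr : Commute (rotInv m) (rot m) := (rotInv_mul_rot m).trans (rot_mul_rotInv m).symm
  refine ⟨_, hq, Eq.trans (Commute.eq ?_) hq⟩
  refine Commute.neg_right (Commute.sum_right _ _ _ fun i _ => ?_)
  refine Commute.mul_right (Commute.sum_right _ _ _ fun k _ => Commute.pow_right ?_ k) ?_ <;>
  exact (Commute.one_left _).sub_left hr

/-- With qD = Dq = (m + 1) - Λ, the trace property gives tr(e_{m+1} q D) = tr(D e_{m+1} q) = tr(e_m
D q), all idempotents having index j + 1; and e_{m+1}^{(j+1)} Λ = Λ e_m^{(j)}. -/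
theorem conjSum_lift_sub (hm : 0 < m) (j : ℕ) (g : Perm (Fin (m + 1))) :
    (m + 1) * conjSum g (eulerianIdem (m + 1) (j + 1)) -
        conjSum g (cyc (m + 1) * inclIdem m j) =
      (m + 1) * conjSum g (inclIdem m (j + 1)) -
        conjSum g (cyc (m + 1) * inclIdem m (j + 1)) := by
  obtain ⟨q, hq, hq'⟩ := exists_sub_rotSum_eq m
  have h := congrArg (signTwist (m + 1)) hq
  have h' := congrArg (signTwist (m + 1)) hq'
  rw [map_mul, map_sub _ _ (rotSum m), map_natCast, ← cyc_eq_signTwist, ← cycDiff] at h h'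
  have key : ∀ x : MonoidAlgebra ℚ (Perm (Fin (m + 1))),
      (m + 1) * conjSum g x - conjSum g (x * cyc (m + 1)) =
        conjSum g (x * (((m + 1 : ℕ) : MonoidAlgebra ℚ (Perm (Fin (m + 1)))) - cyc (m + 1))) :=
    fun x => by
      rw [mul_sub, map_sub, ← nsmul_eq_mul', map_nsmul, nsmul_eq_mul]
      push_cast
      rfl
  rw [cyc_mul_inclIdem hm, conjSum_mul_comm g (cyc (m + 1)), key, key, ← h, ← mul_assoc,
    conjSum_mul_comm, ← mul_assoc, cycDiff_mul_eulerianIdem hm, mul_assoc, h, h']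

theorem cyc_mul_rot : cyc (m + 1) * signTwist (m + 1) (rot m) = cyc (m + 1) := by
  rw [cyc_eq_signTwist, ← map_mul, rotSum_mul_rot]

theorem rot_mul_cyc : signTwist (m + 1) (rot m) * cyc (m + 1) = cyc (m + 1) := by
  rw [cyc_eq_signTwist, ← map_mul, rot_mul_rotSum]

theorem cyc_mul_cyc : cyc (m + 1) * cyc (m + 1) = ((m : ℚ) + 1) • cyc (m + 1) := by
  rw [cyc_eq_signTwist, ← map_mul, ← map_smul]
  congr 1
  nth_rw 1 [rotSum]
  rw [Finset.sum_mul]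
  simp only [rot_pow_mul_rotSum, Finset.sum_const, Finset.card_range]
  rw [← Nat.cast_smul_eq_nsmul ℚ]
  push_cast
  rfl

theorem lift_mul_self (hm : 0 < m) (j : ℕ) :
    cyc (m + 1) * inclIdem m j * (cyc (m + 1) * inclIdem m j) =
      ((m : ℚ) + 1) • (cyc (m + 1) * inclIdem m j) := by
  nth_rw 1 [cyc_mul_inclIdem hm]
  rw [mul_assoc, ← mul_assoc (cyc (m + 1)), cyc_mul_cyc, smul_mul_assoc, mul_smul_comm,
    ← mul_assoc, ← cyc_mul_inclIdem hm, mul_assoc, ← map_mul, eulerianIdem_mul_self hm]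

theorem coeff_inclIdem_of_ne {x : MonoidAlgebra ℚ (Perm (Fin m))} {w : Perm (Fin (m + 1))}
    (hw : w (Fin.last m) ≠ Fin.last m) : (algMap (incl (m + 1)) x).coeff w = 0 := by
  induction x using MonoidAlgebra.induction_linear with
  | zero => simp
  | add x y hx hy => rw [map_add, MonoidAlgebra.coeff_add, Finsupp.add_apply, hx, hy, add_zero]
  | single v r =>
    change (MonoidAlgebra.mapDomain (incl (m + 1)) (.single v r)).coeff w = 0
    rw [MonoidAlgebra.mapDomain_single, MonoidAlgebra.coeff_single, Finsupp.single_apply, if_neg]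
    rintro rfl
    exact hw (incl_last v)

theorem finRotate_pow_last_ne {k : ℕ} (hk : k ∈ Finset.range (m + 1)) (hk0 : k ≠ 0) :
    (finRotate (m + 1) ^ k) (Fin.last m) ≠ Fin.last m := by
  intro h
  have h := congrArg Fin.val h
  rw [Finset.mem_range] at hk
  rw [val_finRotate_pow, Fin.val_last, Nat.mod_eq_sub_mod (by omega),
    Nat.mod_eq_of_lt (by omega)] at h
  omega

/-- On the permutations fixing the last letter, `Λ x` has the same coefficients as `x`. -/
theorem coeff_cyc_mul {x : MonoidAlgebra ℚ (Perm (Fin m))} {w : Perm (Fin (m + 1))}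
    (hw : w (Fin.last m) = Fin.last m) :
    (cyc (m + 1) * algMap (incl (m + 1)) x).coeff w = (algMap (incl (m + 1)) x).coeff w := by
  rw [cyc, Finset.sum_mul, MonoidAlgebra.coeff_sum, Finsupp.finsetSum_apply,
    Finset.sum_eq_single_of_mem 0 (Finset.mem_range.2 m.succ_pos)]
  · rw [pow_zero, pow_zero, ← MonoidAlgebra.one_def, one_mul]
  · intro k hk hk0
    rw [MonoidAlgebra.coeff_single_mul_apply, coeff_inclIdem_of_ne, mul_zero]
    rw [Perm.mul_apply, hw, Ne, Perm.inv_eq_iff_eq, eq_comm]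
    exact finRotate_pow_last_ne hk hk0

/-- The lift absorbs sgn(c) c on the left through Λ, and on the right because it also equals
e_{m+1}^{(j+1)} Λ; under conjugation the signs cancel. -/
theorem coeff_lift_conj (hm : 0 < m) (j k : ℕ) (w : Perm (Fin (m + 1))) :
    (cyc (m + 1) * inclIdem m j).coeff
        (finRotate (m + 1) ^ k * w * (finRotate (m + 1) ^ k)⁻¹) =
      (cyc (m + 1) * inclIdem m j).coeff w := by
  have hl : signTwist (m + 1) (rot m) * (cyc (m + 1) * inclIdem m j) =
      cyc (m + 1) * inclIdem m j := by rw [← mul_assoc, rot_mul_cyc]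
  have hr : cyc (m + 1) * inclIdem m j * signTwist (m + 1) (rot m) =
      cyc (m + 1) * inclIdem m j := by
    rw [cyc_mul_inclIdem hm, mul_assoc, cyc_mul_rot]
  generalize cyc (m + 1) * inclIdem m j = f at hl hr
  rw [rot, signTwist_single] at hl hr
  have hconj : ∀ v, f.coeff (finRotate (m + 1) * v * (finRotate (m + 1))⁻¹) = f.coeff v :=
    fun v => by
      have h1 := congrArg (fun y => y.coeff (finRotate (m + 1) * v * (finRotate (m + 1))⁻¹)) hl
      have h2 := congrArg (fun y => y.coeff (v * (finRotate (m + 1))⁻¹ * finRotate (m + 1))) hr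
      simp only [MonoidAlgebra.coeff_single_mul_apply, MonoidAlgebra.coeff_mul_single_apply]
        at h1 h2
      rw [mul_assoc, inv_mul_cancel_left] at h1
      rw [mul_inv_cancel_right, inv_mul_cancel_right, mul_comm] at h2
      rw [← mul_assoc] at h1
      exact h1.symm.trans h2
  induction k with
  | zero => simp
  | succ k ih =>
    have hk : finRotate (m + 1) ^ (k + 1) * w * (finRotate (m + 1) ^ (k + 1))⁻¹ =
        finRotate (m + 1) * (finRotate (m + 1) ^ k * w * (finRotate (m + 1) ^ k)⁻¹) *
          (finRotate (m + 1))⁻¹ := by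
      rw [pow_succ', mul_inv_rev]
      simp only [mul_assoc]
    rw [hk, hconj, ih]

/-- The number of fixed points times the character of a lift is an induced character. -/
theorem card_mul_conjSum_lift (hm : 0 < m) (j : ℕ) (g : Perm (Fin (m + 1))) :
    (Fintype.card {i // g i = i} : ℚ) * conjSum g (cyc (m + 1) * inclIdem m j) =
      (m + 1) * conjSum g (inclIdem m j) := by
  -- A power of c moves i to the last letter, and conjugation by it preserves the coefficients of
  -- the lift. Conjugates fixing the last letter have the same coefficient in e_m^{(j)}; the others
  -- have coefficient 0 there.
  have hfix : ∀ i : Fin (m + 1), ∑ h : Perm (Fin (m + 1)),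
      (if (h * g * h⁻¹) i = i then (cyc (m + 1) * inclIdem m j).coeff (h * g * h⁻¹) else 0) =
        conjSum g (inclIdem m j) := by
    intro i
    obtain ⟨k, hk⟩ : ∃ k : ℕ, (finRotate (m + 1) ^ k) i = Fin.last m := by
      refine ⟨m - i, Fin.ext ?_⟩
      have := i.2
      rw [val_finRotate_pow, Fin.val_last, Nat.mod_eq_of_lt] <;> omega
    rw [conjSum_apply]
    refine Fintype.sum_equiv (Equiv.mulLeft (finRotate (m + 1) ^ k)) _ _ fun h => ?_
    have hc : finRotate (m + 1) ^ k * h * g * (finRotate (m + 1) ^ k * h)⁻¹ =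
        finRotate (m + 1) ^ k * (h * g * h⁻¹) * (finRotate (m + 1) ^ k)⁻¹ := by group
    rw [Equiv.coe_mulLeft, hc]
    have hiff : (finRotate (m + 1) ^ k * (h * g * h⁻¹) * (finRotate (m + 1) ^ k)⁻¹)
        (Fin.last m) = Fin.last m ↔ (h * g * h⁻¹) i = i := by
      rw [Perm.mul_apply, Perm.mul_apply, Perm.inv_eq_iff_eq.2 hk.symm, ← hk,
        EmbeddingLike.apply_eq_iff_eq]
    split_ifs with hi
    · rw [← coeff_lift_conj hm j k, coeff_cyc_mul (hiff.2 hi)]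
    · rw [coeff_inclIdem_of_ne (mt hiff.1 hi)]
  have hsum := Finset.sum_congr (rfl : (Finset.univ : Finset (Fin (m + 1))) = _)
    fun i _ => hfix i
  rw [Finset.sum_comm, Finset.sum_const, Finset.card_univ, Fintype.card_fin, nsmul_eq_mul] at hsum
  rw [Nat.cast_add, Nat.cast_one] at hsum
  rw [← hsum, conjSum_apply, Finset.mul_sum]
  refine Finset.sum_congr rfl fun h _ => ?_
  rw [Fintype.card_subtype, Finset.card_filter, Nat.cast_sum, Finset.sum_mul]
  -- The fixed points of h g h⁻¹ are the images under h of those of g.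
  refine Fintype.sum_equiv h _ _ fun i => ?_
  have hi : (h * g * h⁻¹) (h i) = h i ↔ g i = i := by simp [Perm.inv_def]
  by_cases hg : g i = i
  · rw [if_pos hg, if_pos (hi.2 hg), Nat.cast_one, one_mul]
  · rw [if_neg hg, if_neg (mt hi.1 hg), Nat.cast_zero, zero_mul]

end Lifts

/-! ### Character identities and their translation into the representation ring -/

section Characters

variable {m : ℕ}

theorem character_E {n : ℕ} (hn : 0 < n) (j : ℕ) (g : Perm (Fin n)) :
    (E n j).character g = conjSum g (eulerianIdem n j) := by
  rw [← character_rightIdeal (r := 1) (by rw [one_smul, eulerianIdem_mul_self hn]), one_mul]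
  rfl

theorem character_F (hm : 0 < m) (j : ℕ) (g : Perm (Fin (m + 1))) :
    ((m : ℚ) + 1) * (F (m + 1) j).character g = conjSum g (cyc (m + 1) * inclIdem m j) :=
  character_rightIdeal (lift_mul_self hm j) g

theorem character_indE (hm : 0 < m) (j : ℕ) (g : Perm (Fin (m + 1))) :
    (indE (m + 1) j).character g = conjSum g (inclIdem m j) := by
  obtain ⟨e⟩ := nonempty_ind_equiv (incl (m + 1)) (eulerianIdem_mul_self hm j)
  have h := congrFun (Representation.char_iso e) g
  refine h.trans ?_
  rw [← character_rightIdeal (r := 1) (by rw [one_smul, ← map_mul, eulerianIdem_mul_self hm]),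
    one_mul]

theorem character_F_add_indE (hm : 0 < m) (j : ℕ) (g : Perm (Fin (m + 1))) :
    (F (m + 1) j).character g + (indE (m + 1) (j + 1)).character g =
      (F (m + 1) (j + 1)).character g + (E (m + 1) (j + 1)).character g := by
  have h := conjSum_lift_sub hm j g
  rw [← character_E m.succ_pos, ← character_F hm, ← character_F hm, ← character_indE hm] at h
  have hm' : ((m : ℚ) + 1) ≠ 0 := by positivity
  refine mul_left_cancel₀ hm' ?_
  linear_combination -h

theorem card_mul_character_F (hm : 0 < m) (j : ℕ) (g : Perm (Fin (m + 1))) :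
    (Fintype.card {i // g i = i} : ℚ) * (F (m + 1) j).character g =
      (indE (m + 1) j).character g := by
  have h := card_mul_conjSum_lift hm j g
  rw [← character_F hm, ← character_indE hm] at h
  have hm' : ((m : ℚ) + 1) ≠ 0 := by positivity
  refine mul_left_cancel₀ hm' ?_
  linear_combination h

theorem character_E_succ (hm : 0 < m) (j : ℕ) (g : Perm (Fin (m + 1))) :
    (E (m + 1) (j + 1)).character g = (F (m + 1) j).character g +
      (reflection (m + 1)).character g * (F (m + 1) (j + 1)).character g := by
  rw [character_reflection m.succ_pos]
  linear_combination -character_F_add_indE hm j g - card_mul_character_F hm (j + 1) g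

theorem character_F_eq_zero (hm : 0 < m) {j : ℕ} (hj : j ∉ Finset.Icc 1 m)
    (g : Perm (Fin (m + 1))) : (F (m + 1) j).character g = 0 := by
  have h := character_F hm j g
  rw [inclIdem, eulerianIdem_eq_zero hm hj, map_zero, mul_zero, map_zero] at h
  exact (mul_eq_zero.1 h).resolve_left (by positivity)

theorem cls_F_add_cls_indE (hm : 0 < m) (j : ℕ) :
    cls (F (m + 1) j) + cls (indE (m + 1) (j + 1)) =
      cls (F (m + 1) (j + 1)) + cls (E (m + 1) (j + 1)) := by
  have : Module.Finite ℚ (Representation.IndV (incl (m + 1)) (E (m + 1 - 1) (j + 1))) :=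
    finiteInd _ _
  rw [← cls_prod, ← cls_prod]
  exact cls_eq_of_character_eq _ _ fun g => by
    rw [character_prod, character_prod, character_F_add_indE hm]

theorem cls_E_succ (hm : 0 < m) (j : ℕ) :
    cls (E (m + 1) (j + 1)) =
      cls (F (m + 1) j) + cls (reflection (m + 1)) * cls (F (m + 1) (j + 1)) :=
  cls_eq_add_mul_of_character_eq _ _ _ _ (character_E_succ hm j)

end Characters

/-! ### The two descriptions of a family of virtual representations -/

section Families

variable {R : Type*} [CommRing R] {m : ℕ}

theorem sum_Icc_sub_eq {A B L : ℕ → R} (h0 : L 0 = 0)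
    (h : ∀ j, L j + B (j + 1) = L (j + 1) + A (j + 1)) (j : ℕ) :
    ∑ i ∈ Finset.Icc 1 j, (B i - A i) = L j := by
  induction j with
  | zero => simp [h0]
  | succ j ih =>
    rw [Finset.sum_Icc_succ_top (Nat.le_add_left 1 j), ih]
    linear_combination h j

/-- The generating series `∑ f_j t ^ (m - j)`. -/
def genSeries (m : ℕ) (f : ℕ → R) : PowerSeries R :=
  ∑ j ∈ Finset.Icc 1 m, PowerSeries.C (f j) * PowerSeries.X ^ (m - j)

theorem genSeries_eq_range (m : ℕ) (f : ℕ → R) :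
    genSeries m f =
      ∑ j ∈ Finset.range m, PowerSeries.C (f (j + 1)) * PowerSeries.X ^ (m - (j + 1)) := by
  rw [genSeries, ← Finset.Ico_add_one_right_eq_Icc, Finset.sum_Ico_eq_sum_range]
  exact Finset.sum_congr rfl fun j _ => by rw [add_comm 1 j]

theorem coeff_genSeries (f : ℕ → R) {j : ℕ} (hj : j ∈ Finset.Icc 1 m) :
    PowerSeries.coeff (m - j) (genSeries m f) = f j := by
  rw [genSeries, map_sum, Finset.sum_eq_single_of_mem j hj]
  · simp
  · intro i hi hij
    rw [PowerSeries.coeff_C_mul, PowerSeries.coeff_X_pow, if_neg, mul_zero]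
    rw [Finset.mem_Icc] at hi hj
    omega

theorem genSeries_eq_iff {f f' : ℕ → R} :
    genSeries m f = genSeries m f' ↔ ∀ j ∈ Finset.Icc 1 m, f j = f' j := by
  constructor
  · intro h j hj
    rw [← coeff_genSeries f hj, h, coeff_genSeries f' hj]
  · intro h
    exact Finset.sum_congr rfl fun j hj => by rw [h j hj]

/-- The two shifted sums overrun the range 1, …, m by one term each, at the indices 0 and m + 1,
where L vanishes. -/
theorem genSeries_succ {A L : ℕ → R} {v : R} (h0 : L 0 = 0) (hm : L (m + 1) = 0)
    (h : ∀ j, A (j + 1) = L j + v * L (j + 1)) :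
    genSeries (m + 1) A =
      (1 + PowerSeries.X * PowerSeries.C v) * genSeries m L := by
  rw [genSeries_eq_range]
  simp only [h, map_add, map_mul, add_mul, Finset.sum_add_distrib, one_mul]
  congr 1
  · rw [Finset.sum_range_succ', h0, map_zero, zero_mul, add_zero, genSeries_eq_range]
    exact Finset.sum_congr rfl fun j _ => by rw [Nat.add_sub_add_right]
  · rw [Finset.sum_range_succ, hm, map_zero, mul_zero, zero_mul, add_zero, genSeries_eq_range,
      Finset.mul_sum]
    refine Finset.sum_congr rfl fun j hj => ?_
    have hj := Finset.mem_range.1 hj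
    rw [show m + 1 - (j + 1) = m - (j + 1) + 1 by omega, pow_succ]
    ring

theorem isUnit_one_add_X_mul_C (v : R) :
    IsUnit (1 + PowerSeries.X * PowerSeries.C v : PowerSeries R) := by
  rw [PowerSeries.isUnit_iff_constantCoeff]
  simp

end Families

end Whitehouse

end

/-! ### The equivalence and the Getzler–Kapranov isomorphism -/

theorem proposition1p1 (n : ℕ) (hn : 2 ≤ n) :
    -- for all families of virtual representations, the virtual description and the graded
    -- relation are equivalent, and they single out Whitehouse's lifts
    (∀ f : ℕ → Whitehouse.RepRing (Equiv.Perm (Fin n)),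
      List.TFAE [
        ∀ j ∈ Finset.Icc 1 (n - 1),
          f j = ∑ i ∈ Finset.Icc 1 j,
            (Whitehouse.cls (Whitehouse.indE n i) - Whitehouse.cls (Whitehouse.E n i)),
        ∑ j ∈ Finset.Icc 1 n,
            PowerSeries.C (Whitehouse.cls (Whitehouse.E n j)) * PowerSeries.X ^ (n - j) =
          (1 + PowerSeries.X * PowerSeries.C (Whitehouse.cls (Whitehouse.reflection n))) *
            ∑ j ∈ Finset.Icc 1 (n - 1), PowerSeries.C (f j) * PowerSeries.X ^ (n - 1 - j),
        ∀ j ∈ Finset.Icc 1 (n - 1), f j = Whitehouse.cls (Whitehouse.F n j)]) ∧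
    -- the isomorphism of representations that the coefficients of `t ^ (n - 1)` express
    Nonempty ((Whitehouse.E n 1).Equiv
      ((Whitehouse.reflection n).tprod (Whitehouse.F n 1))) := by
  obtain ⟨m, rfl⟩ : ∃ m, n = m + 1 := ⟨n - 1, by omega⟩
  have hm : 0 < m := by omega
  have h0 : 0 ∉ Finset.Icc 1 m := by simp
  have hm1 : m + 1 ∉ Finset.Icc 1 m := by simp
  have hF0 := Whitehouse.cls_eq_zero_of_character_eq_zero (Whitehouse.F (m + 1) 0)
    (Whitehouse.character_F_eq_zero hm h0)
  have hFm := Whitehouse.cls_eq_zero_of_character_eq_zero (Whitehouse.F (m + 1) (m + 1))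
    (Whitehouse.character_F_eq_zero hm hm1)
  refine ⟨fun f => ?_,
    Whitehouse.nonempty_equiv_tprod_of_character_eq _ _ _ fun g => ?_⟩
  · have hsum := Whitehouse.sum_Icc_sub_eq (A := fun j => Whitehouse.cls (Whitehouse.E (m + 1) j))
      (B := fun j => Whitehouse.cls (Whitehouse.indE (m + 1) j))
      (L := fun j => Whitehouse.cls (Whitehouse.F (m + 1) j)) hF0
      (Whitehouse.cls_F_add_cls_indE hm)
    have hgen := Whitehouse.genSeries_succ (m := m)
      (A := fun j => Whitehouse.cls (Whitehouse.E (m + 1) j))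
      (L := fun j => Whitehouse.cls (Whitehouse.F (m + 1) j)) hF0 hFm
      (Whitehouse.cls_E_succ hm)
    tfae_have 1 ↔ 3 := by
      refine forall₂_congr fun j _ => ?_
      rw [hsum j]
    tfae_have 2 ↔ 3 := by
      change Whitehouse.genSeries (m + 1) _ = _ * Whitehouse.genSeries m f ↔ _
      -- The lifts satisfy the graded relation; cancelling the unit 1 + tV leaves equality of
      -- coefficients.
      rw [hgen, (Whitehouse.isUnit_one_add_X_mul_C _).mul_right_inj, eq_comm,
        Whitehouse.genSeries_eq_iff]
      rfl
    tfae_finish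
  -- The case j = 0 of the recursion, where the lift of index 0 contributes nothing.
  · rw [Whitehouse.character_E_succ hm 0 g, Whitehouse.character_F_eq_zero hm h0, zero_add]
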